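/- Let $(M,g)$ be a connected (Hausdorff, second countable) smooth Lorentzian manifold of dimension $n+1\ge 2$ and signature $(-,+,\dots,+)$, with Levi-Civita connection $\nabla$. Hypersurfaces are smooth, embedded and without boundary. For $S\subseteq M$, the interior of $S$ in the sense of hypersurfaces is the set of points of $S$ near which $S$ is a hypersurface. A hypersurface is null if the metric induced on each of its tangent spaces is degenerate. A null hypersurface $\mathcal H_\xi$ is a Killing horizon of a (smooth) Killing vector $\xi$ of $(M,g)$ if $\xi$ is null, nowhere zero and tangent on $\mathcal H_\xi$, and $\mathcal H_\xi$ is connected or, if it has several connected components, the interior of its closure (in the above sense) is a connected hypersurface. Its surface gravity is the function $\kappa_\xi:\mathcal H_\xi\to\mathbb R$ with $\nabla_\xi\xi=\kappa_\xi\,\xi$ on $\mathcal H_\xi$. A null hypersurface $\mathcal H$ is a multiple Killing horizon if there are $m\ge 2$ linearly independent Killing vectors $\xi_1,\dots,\xi_m$ of $(M,g)$ with Killing horizons $\mathcal H_{\xi_1},\dots,\mathcal H_{\xi_m}$ such that $\overline{\mathcal H}=\overline{\mathcal H}_{\xi_1}=\dots=\overline{\mathcal H}_{\xi_m}$. Theorem.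 Let $\mathcal H$ be a multiple Killing horizon, and let $\mathcal H_\xi$, $\mathcal H_\eta$ be Killing horizons of Killing vectors $\xi$, $\eta$ such that $\overline{\mathcal H}_\xi=\overline{\mathcal H}_\eta=\overline{\mathcal H}$. Then the surface gravities $\kappa_\xi$ and $\kappa_\eta$ exist, are unique, and are constant on $\mathcal H_\xi$ and $\mathcal H_\eta$, respectively. -/

import Mathlib

open Set
open scoped Manifold ContDiff

namespace KillingHorizons

/-- Vector fields (not necessarily smooth) on an `(n+1)`-dimensional manifold `M`. -/
abbrev VField (n : ℕ) (M : Type*) [TopologicalSpace M]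
    [ChartedSpace (EuclideanSpace ℝ (Fin (n + 1))) M] : Type _ :=
  (p : M) → TangentSpace (𝓡 (n + 1)) p

/-- A smooth Lorentzian metric of signature `(-, +, …, +)` on an `(n+1)`-dimensional
smooth manifold: a smooth field of symmetric bilinear forms which has, at every point, an
orthonormal basis whose first vector has square `-1` and whose other vectors have square `1`. -/
structure LorentzianMetric (n : ℕ) (M : Type*) [TopologicalSpace M]
    [ChartedSpace (EuclideanSpace ℝ (Fin (n + 1))) M] [IsManifold (𝓡 (n + 1)) ∞ M] where
  /-- The bilinear form on the tangent space at `p`. -/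
  val (p : M) : TangentSpace (𝓡 (n + 1)) p →L[ℝ] TangentSpace (𝓡 (n + 1)) p →L[ℝ] ℝ
  symm (p : M) (v w : TangentSpace (𝓡 (n + 1)) p) : val p v w = val p w v
  signature (p : M) : ∃ b : Module.Basis (Fin (n + 1)) ℝ (TangentSpace (𝓡 (n + 1)) p),
    ∀ i j, val p (b i) (b j) = if i = j then (if i = 0 then -1 else 1) else 0
  contMDiff : ContMDiff (𝓡 (n + 1))
    ((𝓡 (n + 1)).prod 𝓘(ℝ, EuclideanSpace ℝ (Fin (n + 1)) →L[ℝ]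
      EuclideanSpace ℝ (Fin (n + 1)) →L[ℝ] ℝ)) ∞
    (fun p ↦ Bundle.TotalSpace.mk' (EuclideanSpace ℝ (Fin (n + 1)) →L[ℝ]
      EuclideanSpace ℝ (Fin (n + 1)) →L[ℝ] ℝ) p (val p))

section Definitions

variable {n : ℕ} {M : Type*} [TopologicalSpace M]
  [ChartedSpace (EuclideanSpace ℝ (Fin (n + 1))) M]

/-- The derivative `X(f)` at `p` of the function `f` along the vector field `X`. -/
noncomputable def along (X : VField n M) (f : M → ℝ) (p : M) : ℝ :=
  mvfderiv (𝓡 (n + 1)) f p (X p)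

/-- The Lie bracket `[X, Y]` of vector fields. -/
noncomputable def bracket (X Y : VField n M) : VField n M :=
  VectorField.mlieBracket (𝓡 (n + 1)) X Y

/-- `f` is a local defining function on the open set `U` for the subset `S` of `M`: it is
smooth on `U`, its differential vanishes nowhere on `U`, and `S ∩ U = {f = 0} ∩ U`. -/
structure IsDefiningFunction (S U : Set M) (f : M → ℝ) : Prop where
  isOpen : IsOpen U
  smooth : ContMDiffOn (𝓡 (n + 1)) 𝓘(ℝ, ℝ) ∞ f U
  submersive : ∀ q ∈ U, mvfderiv (𝓡 (n + 1)) f q ≠ 0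
  zeroSet : ∀ q ∈ U, q ∈ S ↔ f q = 0

variable (n) in
/-- The hypersurface part (manifold interior) of a subset `S` of `M`: the set of the points
of `S` near which `S` is a smooth embedded hypersurface without boundary. It is the largest
relatively open subset of `S` which is an embedded hypersurface. -/
def hypersurfaceInterior (S : Set M) : Set M :=
  {p | p ∈ S ∧ ∃ (U : Set M) (f : M → ℝ), p ∈ U ∧ IsDefiningFunction (n := n) S U f}

variable (n) in
/-- `S` is a smooth embedded hypersurface (codimension one, without boundary) of `M`. -/
def IsHypersurface (S : Set M) : Prop :=
  ∀ p ∈ S, ∃ (U : Set M) (f : M → ℝ), p ∈ U ∧ IsDefiningFunction (n := n) S U f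

/-- The vector `v` at the point `p` of the hypersurface `S` is tangent to `S`. -/
def IsTangent (S : Set M) (p : M) (v : TangentSpace (𝓡 (n + 1)) p) : Prop :=
  ∃ (U : Set M) (f : M → ℝ), p ∈ U ∧ IsDefiningFunction (n := n) S U f ∧
    mvfderiv (𝓡 (n + 1)) f p v = 0

variable [IsManifold (𝓡 (n + 1)) ∞ M]

/-- `X` is differentiable, as a vector field, at the point `p`. -/
def DiffAt (X : VField n M) (p : M) : Prop :=
  MDifferentiableAt (𝓡 (n + 1)) (𝓡 (n + 1)).tangent
    (fun q ↦ (⟨q, X q⟩ : TangentBundle (𝓡 (n + 1)) M)) p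

/-- The function `g(X, Y)`. -/
noncomputable def LorentzianMetric.pairing (g : LorentzianMetric n M) (X Y : VField n M) (p : M) : ℝ :=
  g.val p (X p) (Y p)

/-- `w = (∇_X Y)(p)` for the Levi-Civita connection `∇` of `g`, expressed by the Koszul formula
`2 g(∇_X Y, Z) = X(g(Y,Z)) + Y(g(X,Z)) - Z(g(X,Y)) + g([X,Y],Z) - g([X,Z],Y) - g([Y,Z],X)`
for all vector fields `Z`; there is at most one such vector, see `IsCovDerivAt.unique`. -/
def IsCovDerivAt (g : LorentzianMetric n M) (X Y : VField n M) (p : M)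
    (w : TangentSpace (𝓡 (n + 1)) p) : Prop :=
  ∀ Z : VField n M, DiffAt Z p →
    2 * g.val p w (Z p) =
      along X (g.pairing Y Z) p + along Y (g.pairing X Z) p - along Z (g.pairing X Y) p
        + g.pairing (bracket X Y) Z p - g.pairing (bracket X Z) Y p
        - g.pairing (bracket Y Z) X p

/-- A Killing vector: a smooth vector field `ξ` with `ℒ_ξ g = 0`, that is
`ξ(g(X,Y)) = g([ξ,X],Y) + g(X,[ξ,Y])` for all vector fields `X`, `Y`. -/
structure IsKilling (g : LorentzianMetric n M) (ξ : VField n M) : Prop where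
  smooth : ContMDiff (𝓡 (n + 1)) (𝓡 (n + 1)).tangent ∞
    (fun q ↦ (⟨q, ξ q⟩ : TangentBundle (𝓡 (n + 1)) M))
  lieDeriv : ∀ (p : M) (X Y : VField n M), DiffAt X p → DiffAt Y p →
    along ξ (g.pairing X Y) p = g.pairing (bracket ξ X) Y p + g.pairing X (bracket ξ Y) p

/-- A null hypersurface: a smooth embedded hypersurface on whose tangent spaces the metric
is degenerate. -/
structure IsNullHypersurface (g : LorentzianMetric n M) (S : Set M) : Prop where
  hypersurface : IsHypersurface n S
  degenerate : ∀ p ∈ S, ∃ k : TangentSpace (𝓡 (n + 1)) p, k ≠ 0 ∧ IsTangent S p k ∧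
    ∀ v : TangentSpace (𝓡 (n + 1)) p, IsTangent S p v → g.val p k v = 0

/-- `H` is a Killing horizon of the Killing vector `ξ`: a smooth embedded null hypersurface on
which `ξ` is null, nowhere zero and tangent. It is either connected, or it has several connected
components and the (manifold) interior of its closure is a connected hypersurface. -/
structure IsKillingHorizon (g : LorentzianMetric n M) (ξ : VField n M) (H : Set M) : Prop where
  killing : IsKilling g ξ
  nullHypersurface : IsNullHypersurface g H
  isNull : ∀ p ∈ H, g.val p (ξ p) (ξ p) = 0
  ne_zero : ∀ p ∈ H, ξ p ≠ 0
  tangent : ∀ p ∈ H, IsTangent H p (ξ p)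
  connected : IsConnected H ∨ IsConnected (hypersurfaceInterior n (closure H))

/-- `H` is a multiple Killing horizon: an embedded null hypersurface whose closure is the closure
of Killing horizons of `m ≥ 2` linearly independent Killing vectors. -/
structure IsMultipleKillingHorizon (g : LorentzianMetric n M) (H : Set M) : Prop where
  nullHypersurface : IsNullHypersurface g H
  multiple : ∃ m : ℕ, 2 ≤ m ∧ ∃ (ξ : Fin m → VField n M) (K : Fin m → Set M),
    LinearIndependent ℝ ξ ∧
    ∀ i, IsKillingHorizon g (ξ i) (K i) ∧ closure (K i) = closure H

/-- `κ : H → ℝ` is the surface gravity of `ξ` on `H`: `∇_ξ ξ = κ ξ` on `H`. -/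
def IsSurfaceGravity (g : LorentzianMetric n M) (ξ : VField n M) (H : Set M)
    (κ : H → ℝ) : Prop :=
  ∀ p : H, IsCovDerivAt g ξ ξ p (κ p • ξ p)

theorem LorentzianMetric.eq_of_forall (g : LorentzianMetric n M) {p : M}
    {v w : TangentSpace (𝓡 (n + 1)) p} (h : ∀ z, g.val p v z = g.val p w z) : v = w := by
  obtain ⟨b, hb⟩ := g.signature p
  apply b.repr.injective
  ext j
  have key : ∀ u : TangentSpace (𝓡 (n + 1)) p,
      g.val p u (b j) = b.repr u j * (if j = 0 then -1 else 1) := by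
    intro u
    have hu : g.val p (∑ i, b.repr u i • b i) (b j) =
        b.repr u j * (if j = 0 then -1 else 1) := by
      simp only [map_sum, map_smul, sum_apply, smul_apply,
        hb, smul_eq_mul, mul_ite, mul_zero, Finset.sum_ite_eq', Finset.mem_univ, if_true]
    rwa [b.sum_repr u] at hu
  have hj := h (b j)
  rw [key, key] at hj
  split_ifs at hj <;> simpa using hj

theorem IsCovDerivAt.unique (g : LorentzianMetric n M) {X Y : VField n M} {p : M}
    {v w : TangentSpace (𝓡 (n + 1)) p} (hv : IsCovDerivAt g X Y p v)
    (hw : IsCovDerivAt g X Y p w) : v = w := by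
  apply g.eq_of_forall
  intro z
  have hd : DiffAt (n := n) (M := M)
      (FiberBundle.extend (EuclideanSpace ℝ (Fin (n + 1))) z) p :=
    FiberBundle.mdifferentiableAt_extend (𝓡 (n + 1)) (EuclideanSpace ℝ (Fin (n + 1))) z
  have h := (hv _ hd).trans (hw _ hd).symm
  simpa using h

end Definitions

end KillingHorizons

/-! Existence and uniqueness are pointwise: for a Killing field, `∇_ξ ξ` is half the curl of `ξ♭`
contracted with `ξ`. On the horizon `ξ♭` is proportional to `dψ`, so by a Frobenius argument
(`curl_tangent`) this one-form kills tangent vectors and is a multiple of `ξ♭`.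

For constancy, take a second Killing field `η` with the same horizon. On it `η = f ξ` and `∇_ξ ξ = k
ξ`, `∇_ξ η = l ξ`, whence `l = ξ(f) + f k` (`gravity_eq_ratio`). At a point `x`, the Killing field
`η - f(x) ξ` vanishes. The second covariant derivative of a Killing field is linear in the field, so
its curl has zero covariant derivative at `x`, which gives `dl = f dk` along the horizon
(`fderiv_gravity_eq_ratio`). Differentiating again, `df ∧ dk = 0`; since `ξ(k) = 0`
(`fderiv_gravity_self`), `ξ(f) Y(k) = 0` for tangent `Y` (`fderiv_ratio_mul`).

Suppose `Y(k) ≠ 0` on an open piece. There `ξ(f) = 0`, so `l = f k`, and comparison with `dl = f dk`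
gives `k df = 0`. At a point `q` with `k ≠ 0` the tangential part of `df` vanishes, and skewness
makes the whole first jet of `η - f(q) ξ` vanish. A Killing field on a connected manifold is
determined by its first jet at a point (`eq_smul_of_fderiv_eq`), so `η = f(q) ξ`, contrary to
independence. Hence `dk = 0` along the horizon.

The horizons need not be connected and share only a dense set of points. Replacing the normal `ξ` by
the gradient of `ψ` extends `k` smoothly over the hypersurface part of the common closure, including
zeros of `ξ`; this part is preconnected, and local constancy passes to it by density
(`exists_eventually_gravity_eq`). -/

namespace KillingHorizons

/-! ### Killing fields in a coordinate domain -/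

section Coordinates

set_option maxSynthPendingDepth 3

variable {E : Type*} [NormedAddCommGroup E] [NormedSpace ℝ E]

/-- A smooth nondegenerate symmetric bilinear form on the open set `U` of a vector space. -/
structure CoordMetric (U : Set E) (G : E → E →L[ℝ] E →L[ℝ] ℝ) : Prop where
  isOpen : IsOpen U
  smooth : ContDiffOn ℝ ∞ G U
  symm : ∀ x ∈ U, ∀ v w, G x v w = G x w v
  nondeg : ∀ x ∈ U, ∀ v, (∀ w, G x v w = 0) → v = 0

/-- The Killing equation on an open set `U` of a vector space. -/
structure CoordKilling (U : Set E) (G : E → E →L[ℝ] E →L[ℝ] ℝ) (ξ : E → E) : Prop where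
  smooth : ContDiffOn ℝ ∞ ξ U
  killing : ∀ x ∈ U, ∀ v w, fderiv ℝ G x (ξ x) v w + G x (fderiv ℝ ξ x v) w
    + G x v (fderiv ℝ ξ x w) = 0

/-- The exterior derivative of the one-form `G(ξ, ·)`. -/
noncomputable def curl (G : E → E →L[ℝ] E →L[ℝ] ℝ) (ξ : E → E) (x v w : E) : ℝ :=
  fderiv ℝ G x v (ξ x) w + G x (fderiv ℝ ξ x v) w - fderiv ℝ G x w (ξ x) v
    - G x (fderiv ℝ ξ x w) v

/-- The Christoffel symbols of the first kind. -/
noncomputable def chris (G : E → E →L[ℝ] E →L[ℝ] ℝ) (x u v w : E) : ℝ :=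
  (fderiv ℝ G x u v w + fderiv ℝ G x v u w - fderiv ℝ G x w u v) / 2

theorem hasFDerivAt_bilin {T : E → E →L[ℝ] E →L[ℝ] ℝ} {a b : E → E} {x : E}
    (hT : DifferentiableAt ℝ T x) (ha : DifferentiableAt ℝ a x) (hb : DifferentiableAt ℝ b x) :
    DifferentiableAt ℝ (fun y ↦ T y (a y) (b y)) x ∧
    ∀ X, fderiv ℝ (fun y ↦ T y (a y) (b y)) x X =
      fderiv ℝ T x X (a x) (b x) + T x (fderiv ℝ a x X) (b x) + T x (a x) (fderiv ℝ b x X) := by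
  have h := (hT.hasFDerivAt.clm_apply ha.hasFDerivAt).clm_apply hb.hasFDerivAt
  refine ⟨h.differentiableAt, fun X ↦ ?_⟩
  rw [h.fderiv]
  simp
  ring

theorem hasFDerivAt_trilin {T : E → E →L[ℝ] E →L[ℝ] E →L[ℝ] ℝ} {a b c : E → E} {x : E}
    (hT : DifferentiableAt ℝ T x) (ha : DifferentiableAt ℝ a x) (hb : DifferentiableAt ℝ b x)
    (hc : DifferentiableAt ℝ c x) :
    DifferentiableAt ℝ (fun y ↦ T y (a y) (b y) (c y)) x ∧
    ∀ X, fderiv ℝ (fun y ↦ T y (a y) (b y) (c y)) x X =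
      fderiv ℝ T x X (a x) (b x) (c x) + T x (fderiv ℝ a x X) (b x) (c x)
      + T x (a x) (fderiv ℝ b x X) (c x) + T x (a x) (b x) (fderiv ℝ c x X) := by
  have h := ((hT.hasFDerivAt.clm_apply ha.hasFDerivAt).clm_apply hb.hasFDerivAt).clm_apply
    hc.hasFDerivAt
  refine ⟨h.differentiableAt, fun X ↦ ?_⟩
  rw [h.fderiv]
  simp
  ring

variable {U : Set E} {G : E → E →L[ℝ] E →L[ℝ] ℝ} {ξ η : E → E} {x : E}

section Smooth

variable {F : Type*} [NormedAddCommGroup F] [NormedSpace ℝ F] {f : E → F}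

theorem contDiffAt_of_mem (hU : IsOpen U) (hf : ContDiffOn ℝ ∞ f U) (hx : x ∈ U) :
    ContDiffAt ℝ ∞ f x := hf.contDiffAt (hU.mem_nhds hx)

theorem contDiffOn_fderiv (hU : IsOpen U) (hf : ContDiffOn ℝ ∞ f U) :
    ContDiffOn ℝ ∞ (fderiv ℝ f) U := hf.fderiv_of_isOpen hU (by simp)

theorem differentiableAt_of_mem (hU : IsOpen U) (hf : ContDiffOn ℝ ∞ f U) (hx : x ∈ U) :
    DifferentiableAt ℝ f x := (contDiffAt_of_mem hU hf hx).differentiableAt (by simp)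

theorem fderiv_fderiv_symm (hU : IsOpen U) (hf : ContDiffOn ℝ ∞ f U) (hx : x ∈ U) (u v : E) :
    fderiv ℝ (fderiv ℝ f) x u v = fderiv ℝ (fderiv ℝ f) x v u :=
  (contDiffAt_of_mem hU hf hx).isSymmSndFDerivAt
    (by rw [minSmoothness_of_isRCLikeNormedField]; exact WithTop.coe_le_coe.2 le_top) u v

/-- Functions which agree on an open set have the same derivative there. -/
theorem fderiv_eq_of_eqOn {f₁ f₂ : E → F} (hU : IsOpen U) (h : EqOn f₁ f₂ U) (hx : x ∈ U) :
    fderiv ℝ f₁ x = fderiv ℝ f₂ x :=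
  (h.eventuallyEq_of_mem (hU.mem_nhds hx)).fderiv_eq

end Smooth

namespace CoordMetric

variable (hG : CoordMetric U G)
include hG

theorem diff (hx : x ∈ U) : DifferentiableAt ℝ G x := differentiableAt_of_mem hG.isOpen hG.smooth hx

theorem diff₂ (hx : x ∈ U) : DifferentiableAt ℝ (fderiv ℝ G) x :=
  differentiableAt_of_mem hG.isOpen (contDiffOn_fderiv hG.isOpen hG.smooth) hx

theorem fderiv_symm (hx : x ∈ U) (u v w : E) : fderiv ℝ G x u v w = fderiv ℝ G x u w v := by
  have h1 := (hasFDerivAt_bilin (hG.diff hx) (differentiableAt_const v)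
    (differentiableAt_const w)).2 u
  have h2 := (hasFDerivAt_bilin (hG.diff hx) (differentiableAt_const w)
    (differentiableAt_const v)).2 u
  have h3 := fderiv_eq_of_eqOn (f₁ := fun y ↦ G y v w) (f₂ := fun y ↦ G y w v) hG.isOpen
    (fun y hy ↦ hG.symm y hy v w) hx
  simp at h1 h2
  rw [← h1, ← h2, h3]

theorem fderiv_eq_chris (hx : x ∈ U) (u v w : E) :
    fderiv ℝ G x u v w = chris G x u v w + chris G x u w v := by
  simp only [chris, hG.fderiv_symm hx u w v, hG.fderiv_symm hx v u w, hG.fderiv_symm hx w u v]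
  ring

end CoordMetric

namespace CoordKilling

variable (hξ : CoordKilling U G ξ) (hη : CoordKilling U G η) (hG : CoordMetric U G)

include hG hξ in
theorem diff (hx : x ∈ U) : DifferentiableAt ℝ ξ x := differentiableAt_of_mem hG.isOpen hξ.smooth hx

include hG hξ in
theorem diff₂ (hx : x ∈ U) : DifferentiableAt ℝ (fderiv ℝ ξ) x :=
  differentiableAt_of_mem hG.isOpen (contDiffOn_fderiv hG.isOpen hξ.smooth) hx

include hG hξ hη in
theorem sub_smul (c : ℝ) : CoordKilling U G (fun x ↦ η x - c • ξ x) := by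
  refine ⟨hη.smooth.sub (contDiffOn_const.smul hξ.smooth), fun x hx v w ↦ ?_⟩
  rw [fderiv_fun_sub (hη.diff hG hx) ((hξ.diff hG hx).fun_const_smul c),
    fderiv_fun_const_smul (hξ.diff hG hx)]
  have h1 := hξ.killing x hx v w
  have h2 := hη.killing x hx v w
  simp
  linear_combination h2 - c * h1

include hξ hη hG in
theorem curl_sub_smul (c : ℝ) (hx : x ∈ U) (v w : E) :
    curl G (fun x ↦ η x - c • ξ x) x v w = curl G η x v w - c * curl G ξ x v w := by
  simp only [curl]
  rw [fderiv_fun_sub (hη.diff hG hx) ((hξ.diff hG hx).fun_const_smul c),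
    fderiv_fun_const_smul (hξ.diff hG hx)]
  simp
  ring

include hG hξ in
-- The Killing equation makes the covariant derivative of `ξ♭` skew, so its curl is twice that
-- derivative; the Christoffel term turns `D ξ` into `∇ ξ`.
theorem curl_eq (hx : x ∈ U) (v w : E) :
    curl G ξ x v w = 2 * chris G x v (ξ x) w + 2 * G x (fderiv ℝ ξ x v) w := by
  have h := hξ.killing x hx v w
  simp only [curl, chris]
  rw [hG.fderiv_symm hx w (ξ x) v, hG.symm x hx (fderiv ℝ ξ x w) v]
  linear_combination -h

include hG hξ in
/-- The derivative of the Killing equation. -/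
theorem fderiv_killing (hx : x ∈ U) (u v w : E) :
    fderiv ℝ (fderiv ℝ G) x u (ξ x) v w + fderiv ℝ G x (fderiv ℝ ξ x u) v w
    + fderiv ℝ G x u (fderiv ℝ ξ x v) w + G x (fderiv ℝ (fderiv ℝ ξ) x u v) w
    + fderiv ℝ G x u v (fderiv ℝ ξ x w) + G x v (fderiv ℝ (fderiv ℝ ξ) x u w) = 0 := by
  have hd (z : E) : DifferentiableAt ℝ (fun y ↦ fderiv ℝ ξ y z) x :=
    (hξ.diff₂ hG hx).clm_apply (differentiableAt_const z)
  have hd' (z : E) : fderiv ℝ (fun y ↦ fderiv ℝ ξ y z) x u = fderiv ℝ (fderiv ℝ ξ) x u z := by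
    rw [fderiv_clm_apply (hξ.diff₂ hG hx) (differentiableAt_const z)]; simp
  obtain ⟨d1, e1⟩ := hasFDerivAt_trilin (hG.diff₂ hx) (hξ.diff hG hx) (differentiableAt_const v)
    (differentiableAt_const w)
  obtain ⟨d2, e2⟩ := hasFDerivAt_bilin (hG.diff hx) (hd v) (differentiableAt_const w)
  obtain ⟨d3, e3⟩ := hasFDerivAt_bilin (hG.diff hx) (differentiableAt_const v) (hd w)
  have h0 := congrArg (· u) (fderiv_eq_of_eqOn (f₂ := fun _ ↦ (0 : ℝ)) hG.isOpen
    (fun y hy ↦ hξ.killing y hy v w) hx)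
  rw [fderiv_fun_add (d1.fun_add d2) d3, fderiv_fun_add d1 d2] at h0
  simp only [add_apply, e1, e2, e3, hd', fderiv_fun_const, Pi.zero_apply, zero_apply, map_zero,
    add_zero] at h0
  linear_combination h0

include hG hξ in
/-- The second derivative of a Killing field in terms of its first jet. -/
theorem snd_fderiv_eq (hx : x ∈ U) (u v w : E) :
    2 * G x (fderiv ℝ (fderiv ℝ ξ) x u v) w =
      -(fderiv ℝ (fderiv ℝ G) x u (ξ x) v w + fderiv ℝ G x (fderiv ℝ ξ x u) v w
        + fderiv ℝ G x u (fderiv ℝ ξ x v) w + fderiv ℝ G x u v (fderiv ℝ ξ x w))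
      - (fderiv ℝ (fderiv ℝ G) x v (ξ x) w u + fderiv ℝ G x (fderiv ℝ ξ x v) w u
        + fderiv ℝ G x v (fderiv ℝ ξ x w) u + fderiv ℝ G x v w (fderiv ℝ ξ x u))
      + (fderiv ℝ (fderiv ℝ G) x w (ξ x) u v + fderiv ℝ G x (fderiv ℝ ξ x w) u v
        + fderiv ℝ G x w (fderiv ℝ ξ x u) v + fderiv ℝ G x w u (fderiv ℝ ξ x v)) := by
  -- The signed cyclic sum that produces the Christoffel symbols: by symmetry of `D²ξ` four of its
  -- six occurrences cancel and the other two coincide.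
  have h1 := hξ.fderiv_killing hG hx u v w
  have h2 := hξ.fderiv_killing hG hx v w u
  have h3 := hξ.fderiv_killing hG hx w u v
  have s (a b : E) := fderiv_fderiv_symm hG.isOpen hξ.smooth hx a b
  rw [hG.symm x hx v, s u w] at h1
  rw [hG.symm x hx w, s v u] at h2
  rw [hG.symm x hx u, s w v] at h3
  linear_combination h1 + h2 - h3

include hG hξ in
theorem hasFDerivAt_curl {a b : E → E} (ha : DifferentiableAt ℝ a x) (hb : DifferentiableAt ℝ b x)
    (hx : x ∈ U) : DifferentiableAt ℝ (fun y ↦ curl G ξ y (a y) (b y)) x ∧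
    ∀ X, fderiv ℝ (fun y ↦ curl G ξ y (a y) (b y)) x X =
      fderiv ℝ (fderiv ℝ G) x X (a x) (ξ x) (b x) + fderiv ℝ G x (a x) (fderiv ℝ ξ x X) (b x)
      + fderiv ℝ G x X (fderiv ℝ ξ x (a x)) (b x) + G x (fderiv ℝ (fderiv ℝ ξ) x X (a x)) (b x)
      - (fderiv ℝ (fderiv ℝ G) x X (b x) (ξ x) (a x) + fderiv ℝ G x (b x) (fderiv ℝ ξ x X) (a x)
      + fderiv ℝ G x X (fderiv ℝ ξ x (b x)) (a x) + G x (fderiv ℝ (fderiv ℝ ξ) x X (b x)) (a x))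
      + curl G ξ x (fderiv ℝ a x X) (b x) + curl G ξ x (a x) (fderiv ℝ b x X) := by
  have hd {z : E → E} (hz : DifferentiableAt ℝ z x) :
      DifferentiableAt ℝ (fun y ↦ fderiv ℝ ξ y (z y)) x := (hξ.diff₂ hG hx).clm_apply hz
  have hd' {z : E → E} (hz : DifferentiableAt ℝ z x) (u : E) :
      fderiv ℝ (fun y ↦ fderiv ℝ ξ y (z y)) x u = fderiv ℝ (fderiv ℝ ξ) x u (z x)
        + fderiv ℝ ξ x (fderiv ℝ z x u) := by
    rw [fderiv_clm_apply (hξ.diff₂ hG hx) hz]; simp [add_comm]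
  obtain ⟨d1, e1⟩ := hasFDerivAt_trilin (hG.diff₂ hx) ha (hξ.diff hG hx) hb
  obtain ⟨d2, e2⟩ := hasFDerivAt_bilin (hG.diff hx) (hd ha) hb
  obtain ⟨d3, e3⟩ := hasFDerivAt_trilin (hG.diff₂ hx) hb (hξ.diff hG hx) ha
  obtain ⟨d4, e4⟩ := hasFDerivAt_bilin (hG.diff hx) (hd hb) ha
  refine ⟨((d1.add d2).sub d3).sub d4, fun X ↦ ?_⟩
  simp only [curl]
  rw [fderiv_fun_sub ((d1.fun_add d2).fun_sub d3) d4, fderiv_fun_sub (d1.fun_add d2) d3,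
    fderiv_fun_add d1 d2]
  simp only [add_apply, sub_apply, e1, e2, e3, e4, hd' ha, hd' hb, map_add]
  ring

include hG hξ in
/-- Where a Killing field vanishes, the covariant derivative of its curl vanishes. -/
theorem fderiv_curl_of_eq_zero {a b : E → E} (ha : DifferentiableAt ℝ a x)
    (hb : DifferentiableAt ℝ b x) (hx : x ∈ U) (h0 : ξ x = 0) (X : E) :
    fderiv ℝ (fun y ↦ curl G ξ y (a y) (b y)) x X =
      2 * chris G x X (b x) (fderiv ℝ ξ x (a x)) - 2 * chris G x X (a x) (fderiv ℝ ξ x (b x))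
      + curl G ξ x (fderiv ℝ a x X) (b x) + curl G ξ x (a x) (fderiv ℝ b x X) := by
  rw [(hξ.hasFDerivAt_curl hG ha hb hx).2]
  -- These eliminate `D²ξ`. Every second derivative of `G` then carries the factor `ξ x = 0`, and
  -- only first-order terms remain.
  have h1 := hξ.snd_fderiv_eq hG hx X (a x) (b x)
  have h2 := hξ.snd_fderiv_eq hG hx X (b x) (a x)
  have s (a b c : E) := hG.fderiv_symm hx a b c
  simp only [h0, chris, map_zero, zero_apply] at h1 h2 ⊢
  generalize fderiv ℝ ξ x X = AX at *
  generalize fderiv ℝ ξ x (a x) = Aa at *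
  generalize fderiv ℝ ξ x (b x) = Ab at *
  linarith [s AX (a x) (b x), s X Aa (b x), s X (a x) Ab, s Aa (b x) X, s (a x) Ab X,
    s (a x) AX (b x), s Ab (a x) X, s (b x) (a x) AX, s (b x) X Aa]

include hG hξ in
/-- The differential of the squared norm of a Killing field. -/
theorem fderiv_norm (hx : x ∈ U) (w : E) :
    fderiv ℝ (fun y ↦ G y (ξ y) (ξ y)) x w = - curl G ξ x (ξ x) w := by
  have hd := hξ.diff hG hx
  rw [(hasFDerivAt_bilin (hG.diff hx) hd hd).2, curl]
  have h := hξ.killing x hx (ξ x) w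
  rw [hG.symm x hx (ξ x)] at h ⊢
  linear_combination h

end CoordKilling

end Coordinates

/-! ### Killing fields are determined by their first jet -/

section Uniqueness

set_option maxSynthPendingDepth 3

variable {E : Type*} [NormedAddCommGroup E] [NormedSpace ℝ E]
variable {U : Set E} {G : E → E →L[ℝ] E →L[ℝ] ℝ} {ξ : E → E} {x : E}

theorem CoordMetric.isInvertible [FiniteDimensional ℝ E] (hG : CoordMetric U G) (hx : x ∈ U) :
    (G x).IsInvertible := by
  have hinj : Function.Injective (G x).toLinearMap := by
    rw [← LinearMap.ker_eq_bot, LinearMap.ker_eq_bot']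
    intro v hv
    exact hG.nondeg x hx v fun w ↦ by
      have := congrArg (fun L : E →L[ℝ] ℝ ↦ L w) hv
      simpa using this
  have hfin : Module.finrank ℝ E = Module.finrank ℝ (E →L[ℝ] ℝ) :=
    (Subspace.dual_finrank_eq (K := ℝ) (V := E)).symm.trans
      (LinearMap.toContinuousLinearMap (𝕜 := ℝ) (E := E) (F' := ℝ)).finrank_eq
  refine ⟨(LinearEquiv.ofInjectiveOfFinrankEq (G x).toLinearMap hinj
    hfin).toContinuousLinearEquiv, ?_⟩
  ext v w
  rfl

theorem CoordMetric.contDiffOn_inverse [FiniteDimensional ℝ E] (hG : CoordMetric U G) :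
    ContDiffOn ℝ ∞ (fun x ↦ (G x).inverse) U := fun _ hx ↦
  ((hG.isInvertible hx).contDiffAt_map_inverse.comp _
    (contDiffAt_of_mem hG.isOpen hG.smooth hx)).contDiffWithinAt

theorem abs_trilin_le (T : E →L[ℝ] E →L[ℝ] E →L[ℝ] ℝ) {C r s t : ℝ} {u v w : E} (hT : ‖T‖ ≤ C)
    (hu : ‖u‖ ≤ r) (hv : ‖v‖ ≤ s) (hw : ‖w‖ ≤ t) : |T u v w| ≤ C * r * s * t := by
  have h1 := T.le_of_opNorm_le_of_le hT hu
  have h2 := (T u).le_of_opNorm_le_of_le h1 hv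
  exact (T u v).le_of_opNorm_le_of_le h2 hw

/-- The formula for `D²ξ` is linear in the first jet of `ξ`, so this is the bound needed for
Grönwall. Its three terms in `D²G` and nine in `DG` give `(3 C₂ + 9 C₁) / 2`; the constant used is
slightly larger. -/
theorem CoordKilling.norm_snd_fderiv_le (hξ : CoordKilling U G ξ) (hG : CoordMetric U G)
    (hx : x ∈ U) {C₁ C₂ m r : ℝ} (h1 : ‖fderiv ℝ G x‖ ≤ C₁) (h2 : ‖fderiv ℝ (fderiv ℝ G) x‖ ≤ C₂)
    (hm : 0 ≤ m) (hinv : ∀ z, ‖z‖ ≤ m * ‖G x z‖) (hr : ‖ξ x‖ ≤ r) (hr' : ‖fderiv ℝ ξ x‖ ≤ r)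
    (u : E) : ‖fderiv ℝ (fderiv ℝ ξ) x u‖ ≤ m * (2 * (C₂ + 3 * C₁)) * ‖u‖ * r := by
  have r0 : 0 ≤ r := (norm_nonneg _).trans hr
  have c1 : 0 ≤ C₁ := (norm_nonneg _).trans h1
  have c2 : 0 ≤ C₂ := (ContinuousLinearMap.opNorm_nonneg _).trans h2
  refine ContinuousLinearMap.opNorm_le_bound _ (by positivity) fun v ↦ (hinv _).trans ?_
  have key : ‖G x (fderiv ℝ (fderiv ℝ ξ) x u v)‖ ≤ 2 * (C₂ + 3 * C₁) * ‖u‖ * r * ‖v‖ := by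
    refine ContinuousLinearMap.opNorm_le_bound _ (by positivity) fun w ↦ ?_
    have hA (z : E) : ‖fderiv ℝ ξ x z‖ ≤ r * ‖z‖ := (fderiv ℝ ξ x).le_of_opNorm_le hr' z
    have n (z : E) : ‖z‖ ≤ ‖z‖ := le_rfl
    have b1 (a b c : E) := abs_le.1 (abs_trilin_le (fderiv ℝ (fderiv ℝ G) x a) (C := C₂ * ‖a‖)
      ((fderiv ℝ (fderiv ℝ G) x).le_of_opNorm_le h2 a) hr (n b) (n c))
    have b2 (a b c : E) := abs_le.1 (abs_trilin_le (fderiv ℝ G x) h1 (hA a) (n b) (n c))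
    have b3 (a b c : E) := abs_le.1 (abs_trilin_le (fderiv ℝ G x) h1 (n a) (hA b) (n c))
    have b4 (a b c : E) := abs_le.1 (abs_trilin_le (fderiv ℝ G x) h1 (n a) (n b) (hA c))
    have e := hξ.snd_fderiv_eq hG hx u v w
    rw [Real.norm_eq_abs, abs_le]
    constructor
    · linarith [b1 u v w, b2 u v w, b3 u v w, b4 u v w, b1 v w u, b2 v w u, b3 v w u, b4 v w u,
        b1 w u v, b2 w u v, b3 w u v, b4 w u v]
    · linarith [b1 u v w, b2 u v w, b3 u v w, b4 u v w, b1 v w u, b2 v w u, b3 v w u, b4 v w u,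
        b1 w u v, b2 w u v, b3 w u v, b4 w u v]
  calc _ ≤ m * (2 * (C₂ + 3 * C₁) * ‖u‖ * r * ‖v‖) := by gcongr
    _ = _ := by ring

/-- A Killing field whose first jet vanishes at a point vanishes at all points which can be joined
to it by a segment. -/
theorem CoordKilling.eq_zero_of_segment [FiniteDimensional ℝ E] (hξ : CoordKilling U G ξ)
    (hG : CoordMetric U G) {x₀ x₁ : E} (hseg : segment ℝ x₀ x₁ ⊆ U) (h0 : ξ x₀ = 0)
    (h1 : fderiv ℝ ξ x₀ = 0) : ξ x₁ = 0 := by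
  have hK : IsCompact (segment ℝ x₀ x₁) := by
    rw [segment_eq_image_lineMap]
    exact isCompact_Icc.image (by fun_prop)
  have sm1 := contDiffOn_fderiv hG.isOpen hG.smooth
  have sm2 := contDiffOn_fderiv hG.isOpen sm1
  obtain ⟨C₁, hC₁⟩ := hK.exists_bound_of_continuousOn (sm1.continuousOn.mono hseg)
  obtain ⟨C₂, hC₂⟩ := hK.exists_bound_of_continuousOn (sm2.continuousOn.mono hseg)
  obtain ⟨m, hm⟩ := hK.exists_bound_of_continuousOn
    (hG.contDiffOn_inverse.continuousOn.mono hseg)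
  have hm0 : 0 ≤ m := (norm_nonneg _).trans (hm x₀ (left_mem_segment ℝ _ _))
  have hinv (x : E) (hx : x ∈ segment ℝ x₀ x₁) (z : E) : ‖z‖ ≤ m * ‖G x z‖ := by
    have := (G x).inverse.le_of_opNorm_le (hm x hx) (G x z)
    rwa [(hG.isInvertible (hseg hx)).inverse_apply_self] at this
  let γ : ℝ → E := fun t ↦ AffineMap.lineMap x₀ x₁ t
  have hγ (t : ℝ) (ht : t ∈ Icc (0 : ℝ) 1) : γ t ∈ segment ℝ x₀ x₁ := by
    rw [segment_eq_image_lineMap]; exact mem_image_of_mem _ ht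
  have hγ' (t : ℝ) : HasDerivAt γ (x₁ - x₀) t := AffineMap.hasDerivAt_lineMap
  -- The first jet along the segment satisfies `‖y'‖ ≤ K ‖y‖` with `y 0 = 0`, so Grönwall forces `y
  -- = 0`. The product norm is a maximum, hence the maximum in `K`.
  let y : ℝ → E × (E →L[ℝ] E) := fun t ↦ (ξ (γ t), fderiv ℝ ξ (γ t))
  have hy (t : ℝ) (ht : t ∈ Icc (0 : ℝ) 1) : HasDerivAt y
      (fderiv ℝ ξ (γ t) (x₁ - x₀), fderiv ℝ (fderiv ℝ ξ) (γ t) (x₁ - x₀)) t :=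
    ((hξ.diff hG (hseg (hγ t ht))).hasFDerivAt.comp_hasDerivAt t (hγ' t)).prodMk
      ((hξ.diff₂ hG (hseg (hγ t ht))).hasFDerivAt.comp_hasDerivAt t (hγ' t))
  have hzero := eq_zero_of_abs_deriv_le_mul_abs_self_of_eq_zero_right
    (K := max ‖x₁ - x₀‖ (m * (2 * (C₂ + 3 * C₁)) * ‖x₁ - x₀‖)) (f := y)
    (fun t ht ↦ (hy t ht).continuousAt.continuousWithinAt)
    (fun t ht ↦ (hy t (Ico_subset_Icc_self ht)).hasDerivWithinAt)
    (by simp [y, γ, h0, h1]) (fun t ht ↦ by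
      have htx := hγ t (Ico_subset_Icc_self ht)
      have r1 : ‖ξ (γ t)‖ ≤ ‖y t‖ := le_max_left _ _
      have r2 : ‖fderiv ℝ ξ (γ t)‖ ≤ ‖y t‖ := le_max_right _ _
      rw [Prod.norm_def, max_mul_of_nonneg _ _ (norm_nonneg _)]
      refine max_le_max ?_ ?_
      · exact ((fderiv ℝ ξ (γ t)).le_of_opNorm_le r2 _).trans (mul_comm _ _).le
      · exact hξ.norm_snd_fderiv_le hG (hseg htx) (hC₁ _ htx) (hC₂ _ htx) hm0 (hinv _ htx) r1 r2 _)
  have h := congrArg Prod.fst (hzero 1 (by simp))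
  simpa [y, γ] using h

end Uniqueness

/-! ### Tangential derivatives along a zero set -/

section Tangential

variable {E : Type*} [NormedAddCommGroup E] [NormedSpace ℝ E] [CompleteSpace E]

/-- A function which vanishes on the zero set of a submersion has vanishing tangential
derivative. -/
theorem fderiv_apply_eq_zero_of_zeroSet {ψ h : E → ℝ} {q X : E} (hψ : ContDiffAt ℝ 1 ψ q)
    (hh : ContDiffAt ℝ 1 h q) (hψ' : fderiv ℝ ψ q ≠ 0) (hq : ψ q = 0)
    (hz : ∀ᶠ x in nhds q, ψ x = 0 → h x = 0) (hX : fderiv ℝ ψ q X = 0) : fderiv ℝ h q X = 0 := by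
  -- Being constant on the level set, `h` trivially has a constrained extremum at `q`; the Lagrange
  -- multiplier rule then makes `dh` a multiple of `dψ`.
  have hext : IsLocalExtrOn h {x | ψ x = ψ q} q := by
    left
    filter_upwards [nhdsWithin_le_nhds hz, self_mem_nhdsWithin] with x hx hx'
    simp only [hq] at hx'
    rw [hx hx', hz.self_of_nhds hq]
  obtain ⟨a, b, hab, h⟩ := hext.exists_multipliers_of_hasStrictFDerivAt_1d
    (hψ.hasStrictFDerivAt one_ne_zero) (hh.hasStrictFDerivAt one_ne_zero)
  have hb : b ≠ 0 := by
    rintro rfl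
    have ha : a ≠ 0 := by
      rintro rfl
      exact hab rfl
    simp [ha, hψ'] at h
  have := congrArg (fun L : E →L[ℝ] ℝ ↦ L X) h
  simpa [hX, hb] using this

/-- Continuous functionals separate points, which reduces this to real values. The vector-valued
form is needed for differences of vector fields. -/
theorem fderiv_apply_eq_zero_of_zeroSet' {F : Type*} [NormedAddCommGroup F] [NormedSpace ℝ F]
    {ψ : E → ℝ} {h : E → F} {q X : E} (hψ : ContDiffAt ℝ 1 ψ q)
    (hh : ContDiffAt ℝ 1 h q) (hψ' : fderiv ℝ ψ q ≠ 0) (hq : ψ q = 0)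
    (hz : ∀ᶠ x in nhds q, ψ x = 0 → h x = 0) (hX : fderiv ℝ ψ q X = 0) : fderiv ℝ h q X = 0 := by
  refine SeparatingDual.eq_zero_of_forall_dual_eq_zero (R := ℝ) fun L ↦ ?_
  have := fderiv_apply_eq_zero_of_zeroSet (h := fun x ↦ L (h x)) hψ
    (L.contDiff.contDiffAt.comp q hh) hψ' hq (hz.mono fun x hx h0 ↦ by simp [hx h0]) hX
  have hc : HasFDerivAt (fun x ↦ L (h x)) _ q :=
    L.hasFDerivAt.comp q (hh.differentiableAt one_ne_zero).hasFDerivAt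
  rwa [hc.fderiv] at this

/-- A function whose tangential derivative vanishes on the zero set of a submersion is locally
constant on it. -/
theorem eventually_eq_of_fderiv_eq_zero {U : Set E} (hU : IsOpen U) {ψ h : E → ℝ} {p : E}
    (hp : p ∈ U) (hψ : ContDiffOn ℝ ∞ ψ U) (hh : ContDiffOn ℝ ∞ h U) (hψ' : fderiv ℝ ψ p ≠ 0)
    (hp0 : ψ p = 0)
    (hz : ∀ x ∈ U, ψ x = 0 → ∀ X, fderiv ℝ ψ x X = 0 → fderiv ℝ h x X = 0) :
    ∀ᶠ x in nhds p, ψ x = 0 → h x = h p := by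
  obtain ⟨w, hw⟩ : ∃ w, fderiv ℝ ψ p w = 1 := by
    obtain ⟨v, hv⟩ : ∃ v, fderiv ℝ ψ p v ≠ 0 := by
      by_contra! hc
      exact hψ' (ContinuousLinearMap.ext hc)
    exact ⟨(fderiv ℝ ψ p v)⁻¹ • v, by simp [hv]⟩
  set L := fderiv ℝ ψ p with hL
  -- A shift along `w` alone, chosen so that `L (Φ x - p) = ψ x` and `DΦ = id` at `p`: it flattens
  -- the zero set into the hyperplane `L (y - p) = 0`.
  let Φ : E → E := fun x ↦ x + (ψ x - L (x - p)) • w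
  have hΦc : ContDiffAt ℝ ∞ Φ p := by
    have := contDiffAt_of_mem hU hψ hp
    fun_prop
  have hΦd : HasFDerivAt Φ ((ContinuousLinearEquiv.refl ℝ E : E ≃L[ℝ] E) : E →L[ℝ] E) p := by
    have h1 : HasFDerivAt ψ L p := (differentiableAt_of_mem hU hψ hp).hasFDerivAt
    have h2 : HasFDerivAt (fun x ↦ L (x - p)) L p :=
      L.hasFDerivAt.comp p ((hasFDerivAt_id p).sub_const p)
    have := (hasFDerivAt_id p).add ((h1.sub h2).smul_const w)
    refine this.congr_fderiv ?_
    ext; simp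
  have hLΦ (x : E) : L (Φ x - p) = ψ x := by
    have : Φ x - p = (x - p) + (ψ x - L (x - p)) • w := add_sub_right_comm _ _ _
    rw [this, map_add, map_smul, hw]
    simp
  have hΦp : Φ p = p := by simp [Φ, hp0]
  set e := hΦc.toOpenPartialHomeomorph Φ hΦd (by simp) with he
  have hes : p ∈ e.source := hΦc.mem_toOpenPartialHomeomorph_source hΦd (by simp)
  have hex (x : E) : e x = Φ x := rfl
  have hep : e p = p := hΦp
  have hsc : ContDiffAt ℝ 1 e.symm p := by
    have := hΦc.to_localInverse hΦd (by simp)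
    rw [hΦp] at this
    exact this.of_le (by exact_mod_cast le_top)
  have hpt : p ∈ e.target := hep ▸ e.map_source hes
  have hesp : e.symm p = p := by rw [← hep, e.left_inv hes]; exact hep.symm
  have hev : ∀ᶠ y in nhds p, y ∈ e.target ∧ e.symm y ∈ U ∧ ContDiffAt ℝ 1 e.symm y :=
    (show ∀ᶠ y in nhds p, y ∈ e.target from e.open_target.mem_nhds hpt).and ((hsc.continuousAt.eventually
      (by rw [hesp]; exact hU.mem_nhds hp)).and (hsc.eventually (by simp)))
  obtain ⟨ε, hε, hball⟩ := Metric.eventually_nhds_iff_ball.1 hev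
  have hΦev : ∀ᶠ x in nhds p, Φ x ∈ Metric.ball p ε :=
    hΦc.continuousAt.eventually (by rw [hΦp]; exact Metric.ball_mem_nhds p hε)
  filter_upwards [e.open_source.mem_nhds hes, hΦev] with x hxs hxb hx0
  -- Since `ψ x = 0`, this segment lies in the hyperplane; its image under `e.symm` is a curve in
  -- the zero set from `p` to `x`, along which `h` has zero derivative.
  let γ : ℝ → E := fun t ↦ p + t • (Φ x - p)
  have hγb (t : ℝ) (ht : t ∈ Icc (0 : ℝ) 1) : γ t ∈ Metric.ball p ε := by
    rw [mem_ball_iff_norm] at hxb ⊢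
    simp only [γ, add_sub_cancel_left, norm_smul, Real.norm_eq_abs, abs_of_nonneg ht.1]
    nlinarith [ht.2, norm_nonneg (Φ x - p)]
  have hγ0 (t : ℝ) : L (γ t - p) = 0 := by
    simp only [γ, add_sub_cancel_left, map_smul, hLΦ, hx0, smul_zero]
  have hsymm (y : E) (hy : y ∈ Metric.ball p ε) : ψ (e.symm y) = L (y - p) := by
    rw [← hLΦ, ← hex, e.right_inv (hball y hy).1]
  have hderiv (t : ℝ) (ht : t ∈ Icc (0 : ℝ) 1) :
      HasDerivAt (fun t ↦ h (e.symm (γ t))) 0 t := by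
    obtain ⟨_, hyU, hyc⟩ := hball _ (hγb t ht)
    have hγd : HasDerivAt γ (Φ x - p) t := by
      refine (((hasDerivAt_id t).smul_const (Φ x - p)).const_add p).congr_deriv ?_
      simp
    have hsd := (hyc.differentiableAt one_ne_zero).hasFDerivAt
    have hψ0 : fderiv ℝ ψ (e.symm (γ t)) (fderiv ℝ e.symm (γ t) (Φ x - p)) = 0 := by
      have h1 := (differentiableAt_of_mem hU hψ hyU).hasFDerivAt.comp (γ t) hsd
      have h2 : HasFDerivAt (fun y ↦ L (y - p)) L (γ t) :=
        L.hasFDerivAt.comp _ ((hasFDerivAt_id _).sub_const p)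
      have h3 : ψ ∘ e.symm =ᶠ[nhds (γ t)] fun y ↦ L (y - p) := by
        filter_upwards [Metric.isOpen_ball.mem_nhds (hγb t ht)] with y hy using hsymm y hy
      have := congrArg (fun L : E →L[ℝ] ℝ ↦ L (Φ x - p)) (h1.unique (h2.congr_of_eventuallyEq h3))
      simpa [hLΦ, hx0] using this
    have := ((differentiableAt_of_mem hU hh hyU).hasFDerivAt.comp (γ t) hsd).comp_hasDerivAt t hγd
    refine this.congr_deriv ?_
    exact hz _ hyU (by rw [hsymm _ (hγb t ht), hγ0]) _ hψ0
  have := constant_of_has_deriv_right_zero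
    (fun t ht ↦ (hderiv t ht).continuousAt.continuousWithinAt)
    (fun t ht ↦ (hderiv t (Ico_subset_Icc_self ht)).hasDerivWithinAt) 1 (by simp)
  have hx1 : e.symm (Φ x) = x := e.left_inv hxs
  simpa [γ, hx1, hesp] using this

end Tangential

/-! ### One Killing field on its horizon -/

section Horizon

set_option maxSynthPendingDepth 3

variable {E : Type*} [NormedAddCommGroup E] [NormedSpace ℝ E]

theorem fderiv_div_apply {n d : E → ℝ} {x : E} (hn : DifferentiableAt ℝ n x)
    (hd : DifferentiableAt ℝ d x) (h0 : d x ≠ 0) (X : E) :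
    fderiv ℝ (fun y ↦ n y / d y) x X =
      (fderiv ℝ n x X * d x - n x * fderiv ℝ d x X) / d x ^ 2 := by
  have h1 : HasFDerivAt (fun y ↦ (d y)⁻¹) (-(d x ^ 2)⁻¹ • fderiv ℝ d x) x :=
    (hasDerivAt_inv h0).comp_hasFDerivAt x hd.hasFDerivAt
  simp only [div_eq_mul_inv]
  rw [(hn.hasFDerivAt.fun_mul h1).fderiv]
  simp
  field_simp
  ring

theorem exists_eq_mul_of_ker_le {L M : E →L[ℝ] ℝ} (hL : L ≠ 0) (h : ∀ X, L X = 0 → M X = 0) :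
    ∃ c : ℝ, ∀ w, M w = c * L w := by
  obtain ⟨v, hv⟩ : ∃ v, L v ≠ 0 := by
    by_contra! hc
    exact hL (ContinuousLinearMap.ext hc)
  refine ⟨M v / L v, fun w ↦ ?_⟩
  have := h (L v • w - L w • v) (by simp; ring)
  simp at this
  field_simp
  linarith

/-- `{ψ = 0}` is a hypersurface of `U` to which the nowhere zero Killing field `ξ` is both tangent
and orthogonal. -/
structure CoordHorizon (U : Set E) (G : E → E →L[ℝ] E →L[ℝ] ℝ) (ψ : E → ℝ) (ξ : E → E) :
    Prop where
  metric : CoordMetric U G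
  killing : CoordKilling U G ξ
  smooth : ContDiffOn ℝ ∞ ψ U
  submersive : ∀ x ∈ U, fderiv ℝ ψ x ≠ 0
  ne_zero : ∀ x ∈ U, ψ x = 0 → ξ x ≠ 0
  tangent : ∀ x ∈ U, ψ x = 0 → fderiv ℝ ψ x (ξ x) = 0
  normal : ∀ x ∈ U, ψ x = 0 → ∀ X, fderiv ℝ ψ x X = 0 → G x (ξ x) X = 0

theorem CoordMetric.mono {U V : Set E} {G : E → E →L[ℝ] E →L[ℝ] ℝ} (h : CoordMetric U G)
    (hV : IsOpen V) (hVU : V ⊆ U) : CoordMetric V G :=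
  ⟨hV, h.smooth.mono hVU, fun x hx ↦ h.symm x (hVU hx), fun x hx ↦ h.nondeg x (hVU hx)⟩

theorem CoordKilling.mono {U V : Set E} {G : E → E →L[ℝ] E →L[ℝ] ℝ} {ξ : E → E}
    (h : CoordKilling U G ξ) (hVU : V ⊆ U) : CoordKilling V G ξ :=
  ⟨h.smooth.mono hVU, fun x hx ↦ h.killing x (hVU hx)⟩

/-- The surface gravity of `ζ` with respect to the normal `ξ`, tested against `w`. -/
noncomputable def gravity (G : E → E →L[ℝ] E →L[ℝ] ℝ) (ζ ξ : E → E) (w x : E) : ℝ :=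
  curl G ζ x (ξ x) w / (2 * G x (ξ x) w)

theorem curl_self (G : E → E →L[ℝ] E →L[ℝ] ℝ) (ξ : E → E) (x v : E) : curl G ξ x v v = 0 := by
  simp [curl]

/-- The one-form `curl G ξ x v`. -/
noncomputable def curlForm (G : E → E →L[ℝ] E →L[ℝ] ℝ) (ξ : E → E) (x v : E) : E →L[ℝ] ℝ :=
  fderiv ℝ G x v (ξ x) + G x (fderiv ℝ ξ x v) - ((fderiv ℝ G x).flip (ξ x)).flip v
    - (G x).flip v ∘L fderiv ℝ ξ x

theorem curlForm_apply (G : E → E →L[ℝ] E →L[ℝ] ℝ) (ξ : E → E) (x v w : E) :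
    curlForm G ξ x v w = curl G ξ x v w := by
  simp [curlForm, curl]

variable {U : Set E} {G : E → E →L[ℝ] E →L[ℝ] ℝ} {ψ : E → ℝ} {ξ η ζ : E → E} {x w : E}

theorem contDiffOn_curl (hG : CoordMetric U G) (hξ : CoordKilling U G ζ) {a b : E → E}
    (ha : ContDiffOn ℝ ∞ a U) (hb : ContDiffOn ℝ ∞ b U) :
    ContDiffOn ℝ ∞ (fun x ↦ curl G ζ x (a x) (b x)) U := by
  have h1 := contDiffOn_fderiv hG.isOpen hG.smooth
  have h2 := contDiffOn_fderiv hG.isOpen hξ.smooth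
  have h3 := hG.smooth
  have h4 := hξ.smooth
  unfold curl
  exact ((((h1.clm_apply ha).clm_apply h4).clm_apply hb).add
    ((h3.clm_apply (h2.clm_apply ha)).clm_apply hb)).sub
    (((h1.clm_apply hb).clm_apply h4).clm_apply ha) |>.sub
    ((h3.clm_apply (h2.clm_apply hb)).clm_apply ha)

theorem contDiffOn_gravity (hG : CoordMetric U G) (hζ : CoordKilling U G ζ)
    (hξ : CoordKilling U G ξ) (hw : ∀ x ∈ U, G x (ξ x) w ≠ 0) :
    ContDiffOn ℝ ∞ (gravity G ζ ξ w) U :=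
  (contDiffOn_curl hG hζ hξ.smooth contDiffOn_const).div
    (contDiffOn_const.mul ((hG.smooth.clm_apply hξ.smooth).clm_apply contDiffOn_const))
    fun x hx ↦ mul_ne_zero two_ne_zero (hw x hx)

theorem fderiv_gravity (hG : CoordMetric U G) (hζ : CoordKilling U G ζ)
    (hξ : CoordKilling U G ξ) (hx : x ∈ U) (hw : G x (ξ x) w ≠ 0) (X : E) :
    fderiv ℝ (gravity G ζ ξ w) x X =
      (fderiv ℝ (fun y ↦ curl G ζ y (ξ y) w) x X - 2 * gravity G ζ ξ w x *
        (fderiv ℝ G x X (ξ x) w + G x (fderiv ℝ ξ x X) w)) / (2 * G x (ξ x) w) := by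
  have h1 := (hζ.hasFDerivAt_curl hG (hξ.diff hG hx) (differentiableAt_const w) hx).1
  obtain ⟨h2, h3⟩ := hasFDerivAt_bilin (hG.diff hx) (hξ.diff hG hx) (differentiableAt_const w)
  unfold gravity
  rw [fderiv_div_apply h1 (h2.const_mul 2) (mul_ne_zero two_ne_zero hw), fderiv_const_mul h2]
  simp only [smul_apply, h3, smul_eq_mul]
  simp
  field_simp

theorem gravity_sub_smul (hG : CoordMetric U G) (hη : CoordKilling U G η)
    (hξ : CoordKilling U G ξ) (c : ℝ) (hx : x ∈ U) :
    gravity G (fun x ↦ η x - c • ξ x) ξ w x = gravity G η ξ w x - c * gravity G ξ ξ w x := by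
  simp only [gravity, hξ.curl_sub_smul hη hG c hx]
  ring

namespace CoordHorizon

theorem mono {V : Set E} (h : CoordHorizon U G ψ ξ) (hV : IsOpen V) (hVU : V ⊆ U) :
    CoordHorizon V G ψ ξ :=
  ⟨h.metric.mono hV hVU, h.killing.mono hVU, h.smooth.mono hVU, fun x hx ↦ h.submersive x (hVU hx),
    fun x hx ↦ h.ne_zero x (hVU hx), fun x hx ↦ h.tangent x (hVU hx),
    fun x hx ↦ h.normal x (hVU hx)⟩

variable (h : CoordHorizon U G ψ ξ) (h' : CoordHorizon U G ψ η)
include h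

theorem exists_normal (hx : x ∈ U) (h0 : ψ x = 0) :
    ∃ c : ℝ, c ≠ 0 ∧ ∀ w, G x (ξ x) w = c * fderiv ℝ ψ x w := by
  obtain ⟨c, hc⟩ := exists_eq_mul_of_ker_le (h.submersive x hx) (h.normal x hx h0)
  refine ⟨c, ?_, hc⟩
  rintro rfl
  exact h.ne_zero x hx h0 (h.metric.nondeg x hx _ fun w ↦ by simp [hc])

/-- Comparison of a one-form vanishing on the tangent space with the conormal. -/
theorem exists_eq_mul (hx : x ∈ U) (h0 : ψ x = 0) {M : E →L[ℝ] ℝ}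
    (hM : ∀ X, fderiv ℝ ψ x X = 0 → M X = 0) : ∃ c : ℝ, ∀ w, M w = c * G x (ξ x) w := by
  obtain ⟨c, hc0, hc⟩ := h.exists_normal hx h0
  obtain ⟨d, hd⟩ := exists_eq_mul_of_ker_le (h.submersive x hx) hM
  refine ⟨d / c, fun w ↦ ?_⟩
  rw [hd, hc]
  field_simp

theorem contDiffAt_one (hx : x ∈ U) : ContDiffAt ℝ 1 ψ x :=
  (contDiffAt_of_mem h.metric.isOpen h.smooth hx).of_le (by exact_mod_cast le_top)

variable [CompleteSpace E]

/-- A function which vanishes on the horizon has vanishing tangential derivative. -/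
theorem fderiv_eq_zero {F : Type*} [NormedAddCommGroup F] [NormedSpace ℝ F] {f : E → F}
    (hf : ContDiffOn ℝ ∞ f U) (hf0 : ∀ y ∈ U, ψ y = 0 → f y = 0) (hx : x ∈ U) (h0 : ψ x = 0)
    {X : E} (hX : fderiv ℝ ψ x X = 0) : fderiv ℝ f x X = 0 :=
  fderiv_apply_eq_zero_of_zeroSet' (h.contDiffAt_one hx)
    ((contDiffAt_of_mem h.metric.isOpen hf hx).of_le (by exact_mod_cast le_top))
    (h.submersive x hx) h0
    (Filter.eventually_of_mem (h.metric.isOpen.mem_nhds hx) hf0) hX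

/-- The horizon is totally geodesic. -/
theorem curl_tangent (hx : x ∈ U) (h0 : ψ x = 0) {X Y : E} (hX : fderiv ℝ ψ x X = 0)
    (hY : fderiv ℝ ψ x Y = 0) : curl G ξ x X Y = 0 := by
  obtain ⟨w, hw⟩ : ∃ w, fderiv ℝ ψ x w ≠ 0 := by
    by_contra! hc
    exact h.submersive x hx (ContinuousLinearMap.ext hc)
  have hU := h.metric.isOpen
  have sψ := contDiffOn_fderiv hU h.smooth
  have sα := h.metric.smooth.clm_apply h.killing.smooth
  -- Proportionality of `ξ♭` and `dψ` on the horizon makes the minor `G(ξ,Y) dψ(w) - G(ξ,w) dψ(Y)`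
  -- vanish there; differentiate it along `X`. The right-hand side is symmetric in `X` and `Y`, so
  -- antisymmetrizing leaves the curl alone.
  have key (X Y : E) (hX : fderiv ℝ ψ x X = 0) (hY : fderiv ℝ ψ x Y = 0) :
      (fderiv ℝ G x X (ξ x) Y + G x (fderiv ℝ ξ x X) Y) * fderiv ℝ ψ x w =
        G x (ξ x) w * fderiv ℝ (fderiv ℝ ψ) x X Y := by
    have s1 (Y : E) := sψ.clm_apply (contDiffOn_const (c := Y))
    have s2 (Y : E) := sα.clm_apply (contDiffOn_const (c := Y))
    have hd := h.fderiv_eq_zero (f := fun y ↦ G y (ξ y) Y * fderiv ℝ ψ y w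
      - G y (ξ y) w * fderiv ℝ ψ y Y) (((s2 Y).mul (s1 w)).sub ((s2 w).mul (s1 Y)))
      (fun y hy hy0 ↦ by
        obtain ⟨c, -, hc⟩ := h.exists_normal hy hy0
        rw [hc, hc]; ring) hx h0 hX
    have d1 (Y : E) := differentiableAt_of_mem hU (s1 Y) hx
    have d2 (Y : E) := differentiableAt_of_mem hU (s2 Y) hx
    have e1 (Y : E) : fderiv ℝ (fun y ↦ fderiv ℝ ψ y Y) x X = fderiv ℝ (fderiv ℝ ψ) x X Y := by
      rw [fderiv_clm_apply (differentiableAt_of_mem hU sψ hx) (differentiableAt_const Y)]; simp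
    have e2 := (hasFDerivAt_bilin (h.metric.diff hx) (h.killing.diff h.metric hx)
      (differentiableAt_const Y)).2 X
    rw [fderiv_fun_sub ((d2 Y).fun_mul (d1 w)) ((d2 w).fun_mul (d1 Y)),
      fderiv_fun_mul (d2 Y) (d1 w), fderiv_fun_mul (d2 w) (d1 Y)] at hd
    simp only [sub_apply, add_apply, smul_apply, e1, e2, smul_eq_mul, hY,
      h.normal x hx h0 Y hY] at hd
    simp at hd
    linear_combination hd
  have h1 := key X Y hX hY
  have h2 := key Y X hY hX
  rw [fderiv_fderiv_symm hU h.smooth hx] at h2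
  apply mul_right_cancel₀ hw
  rw [curl]
  linear_combination h1 - h2

omit [CompleteSpace E] in
/-- The surface gravity of a Killing field whose curl vanishes on the tangent space. -/
theorem exists_gravity (hx : x ∈ U) (h0 : ψ x = 0)
    (hζ : ∀ X, fderiv ℝ ψ x X = 0 → curl G ζ x (ξ x) X = 0) :
    ∃ κ : ℝ, ∀ w, curl G ζ x (ξ x) w = 2 * κ * G x (ξ x) w := by
  obtain ⟨c, hc⟩ := h.exists_eq_mul hx h0 (M := curlForm G ζ x (ξ x))
    (fun X hX ↦ by rw [curlForm_apply, hζ X hX])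
  refine ⟨c / 2, fun w ↦ ?_⟩
  rw [← curlForm_apply, hc]
  ring

omit h [CompleteSpace E] in
theorem gravity_eq {κ : ℝ} (hκ : ∀ w, curl G ζ x (ξ x) w = 2 * κ * G x (ξ x) w)
    (hw : G x (ξ x) w ≠ 0) : gravity G ζ ξ w x = κ := by
  rw [gravity, hκ]
  field_simp

/-- The surface gravity of a Killing field is critical, along the horizon, where the field
vanishes. -/
theorem fderiv_gravity_eq_zero (hζ : CoordKilling U G ζ) (hx : x ∈ U) (h0 : ψ x = 0)
    (hζ0 : ζ x = 0) (hζt : ∀ X, fderiv ℝ ψ x X = 0 → curl G ζ x (ξ x) X = 0)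
    (hw : G x (ξ x) w ≠ 0) {X : E} (hX : fderiv ℝ ψ x X = 0) :
    fderiv ℝ (gravity G ζ ξ w) x X = 0 := by
  have hG := h.metric
  have hξ := h.killing
  obtain ⟨κ, hκ⟩ := h.exists_gravity hx h0 hζt
  -- That is, `∇_X ξ = (τ/2) ξ`. Differentiating `curl ζ (ξ, w) = 2 κ G(ξ, w)` covariantly along
  -- `X`, with the derivative of `curl ζ` zero at `x`, the two `τ` terms cancel and `X(κ) = 0`
  -- remains.
  obtain ⟨τ, hτ⟩ := h.exists_eq_mul hx h0 (M := curlForm G ξ x X)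
    (fun Y hY ↦ by rw [curlForm_apply, h.curl_tangent hx h0 hX hY])
  simp only [curlForm_apply] at hτ
  have hA (a b : E) : curl G ζ x a b = 2 * G x (fderiv ℝ ζ x a) b := by
    rw [hζ.curl_eq hG hx]; simp [hζ0, chris]
  have hAξ : fderiv ℝ ζ x (ξ x) = κ • ξ x := by
    rw [← sub_eq_zero]
    refine hG.nondeg x hx _ fun z ↦ ?_
    have := hκ z
    rw [hA] at this
    simp
    linarith
  rw [fderiv_gravity hG hζ hξ hx hw, gravity_eq hκ hw,
    hζ.fderiv_curl_of_eq_zero hG (hξ.diff hG hx) (differentiableAt_const w) hx hζ0]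
  have e1 := hτ w
  have e2 := hτ (fderiv ℝ ζ x w)
  rw [hξ.curl_eq hG hx] at e1 e2
  have e4 := hζ.killing x hx (fderiv ℝ ξ x X) w
  have e5 := hζ.killing x hx (ξ x) w
  have e7 : chris G x X w (κ • ξ x) = κ * chris G x X w (ξ x) := by simp [chris]; ring
  rw [hA, hAξ, e7, hG.fderiv_eq_chris hx X]
  rw [hζ0] at e4 e5
  simp at e4 e5 ⊢
  left
  rw [hAξ] at e5
  simp at e5
  have e8 : curl G ζ x (ξ x) 0 = 0 := by simp [curl]
  linear_combination (-e2) - κ * e1 + 2 * e4 - τ * e5 + e8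

/-- The surface gravity is constant along the generators of the horizon. -/
theorem fderiv_gravity_self (hx : x ∈ U) (h0 : ψ x = 0) (hw : G x (ξ x) w ≠ 0) :
    fderiv ℝ (gravity G ξ ξ w) x (ξ x) = 0 := by
  have hG := h.metric
  have hξ := h.killing
  have hU := hG.isOpen
  obtain ⟨κ, hκ⟩ := h.exists_gravity hx h0 fun X hX ↦ h.curl_tangent hx h0 (h.tangent x hx h0) hX
  rw [fderiv_gravity hG hξ hξ hx hw, gravity_eq hκ hw]
  -- The numerator of the gravity is `-dφ(w)`, while `dφ(ξ) = 0` on all of `U`. Differentiating the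
  -- latter along `w` and commuting second derivatives gives the derivative of the former along `ξ`.
  set φ : E → ℝ := fun y ↦ G y (ξ y) (ξ y) with hφ
  have sφ : ContDiffOn ℝ ∞ φ U := (hG.smooth.clm_apply hξ.smooth).clm_apply hξ.smooth
  have dφ := differentiableAt_of_mem hU (contDiffOn_fderiv hU sφ) hx
  have e1 : fderiv ℝ (fun y ↦ curl G ξ y (ξ y) w) x =
      fderiv ℝ (fun y ↦ - fderiv ℝ φ y w) x :=
    fderiv_eq_of_eqOn hU (fun y hy ↦ by simp [hφ, hξ.fderiv_norm hG hy w]) hx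
  have e2 : fderiv ℝ (fun y ↦ fderiv ℝ φ y (ξ y)) x = fderiv ℝ (fun _ ↦ (0 : ℝ)) x :=
    fderiv_eq_of_eqOn hU (fun y hy ↦ by simp [hφ, hξ.fderiv_norm hG hy, curl_self]) hx
  have e3 := congrArg (fun L : E →L[ℝ] ℝ ↦ L w) e2
  rw [fderiv_clm_apply dφ (hξ.diff hG hx)] at e3
  simp at e3
  have e4 : fderiv ℝ φ x (fderiv ℝ ξ x w) = -(2 * κ * G x (ξ x) (fderiv ℝ ξ x w)) := by
    rw [hξ.fderiv_norm hG hx, hκ]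
  have e5 := hξ.killing x hx (ξ x) w
  have e6 : fderiv ℝ (fun y ↦ - fderiv ℝ φ y w) x (ξ x) =
      - fderiv ℝ (fderiv ℝ φ) x (ξ x) w := by
    rw [fderiv_fun_neg, fderiv_clm_apply dφ (differentiableAt_const w)]; simp
  rw [e1, e6, fderiv_fderiv_symm hU sφ hx]
  have : fderiv ℝ (fderiv ℝ φ) x w (ξ x) = 2 * κ * G x (ξ x) (fderiv ℝ ξ x w) := by
    linarith
  rw [this]
  simp
  left
  linear_combination (- 2 * κ) * e5

end CoordHorizon

end Horizon

/-! ### Two Killing fields sharing a horizon -/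

section TwoHorizons

set_option maxSynthPendingDepth 3

variable {E : Type*} [NormedAddCommGroup E] [NormedSpace ℝ E]
variable {U : Set E} {G : E → E →L[ℝ] E →L[ℝ] ℝ} {ψ : E → ℝ} {ξ η : E → E} {x w : E}

/-- The proportionality factor of two fields, tested against `w`. -/
noncomputable def ratio (G : E → E →L[ℝ] E →L[ℝ] ℝ) (η ξ : E → E) (w x : E) : ℝ :=
  G x (η x) w / G x (ξ x) w

/-- A vector field tangent to the level sets of `ψ`. -/
noncomputable def tangentField (ψ : E → ℝ) (w u x : E) : E :=
  fderiv ℝ ψ x w • u - fderiv ℝ ψ x u • w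

namespace CoordHorizon

theorem contDiffOn_ratio (hG : CoordMetric U G) (hη : CoordKilling U G η)
    (hξ : CoordKilling U G ξ) (hw : ∀ x ∈ U, G x (ξ x) w ≠ 0) :
    ContDiffOn ℝ ∞ (ratio G η ξ w) U :=
  ((hG.smooth.clm_apply hη.smooth).clm_apply contDiffOn_const).div
    ((hG.smooth.clm_apply hξ.smooth).clm_apply contDiffOn_const) hw

variable (h : CoordHorizon U G ψ ξ) (h' : CoordHorizon U G ψ η)
include h h'

/-- Both fields are normal to the hypersurface and the normal direction is a line; pairing with `w`
reads off the factor. -/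
theorem eq_ratio_smul (hx : x ∈ U) (h0 : ψ x = 0) (hw : G x (ξ x) w ≠ 0) :
    η x = ratio G η ξ w x • ξ x := by
  rw [← sub_eq_zero]
  refine h.metric.nondeg x hx _ fun z ↦ ?_
  obtain ⟨c, hc⟩ := h.exists_eq_mul hx h0 (h'.normal x hx h0)
  simp only [ratio, map_sub, map_smul, sub_apply, smul_apply, smul_eq_mul, hc]
  field_simp
  ring

variable [CompleteSpace E]

theorem curl_eq_zero (hx : x ∈ U) (h0 : ψ x = 0) {X : E} (hX : fderiv ℝ ψ x X = 0) :
    curl G η x (ξ x) X = 0 := h'.curl_tangent hx h0 (h.tangent x hx h0) hX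

theorem fderiv_eq_ratio (hw : ∀ x ∈ U, G x (ξ x) w ≠ 0) (hx : x ∈ U) (h0 : ψ x = 0) {X : E}
    (hX : fderiv ℝ ψ x X = 0) : fderiv ℝ η x X =
      fderiv ℝ (ratio G η ξ w) x X • ξ x + ratio G η ξ w x • fderiv ℝ ξ x X := by
  have sf := contDiffOn_ratio h.metric h'.killing h.killing hw
  have df := differentiableAt_of_mem h.metric.isOpen sf hx
  have dξ := h.killing.diff h.metric hx
  have dη := h'.killing.diff h.metric hx
  have := h.fderiv_eq_zero (f := fun y ↦ η y - ratio G η ξ w y • ξ y)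
    (h'.killing.smooth.sub (sf.smul h.killing.smooth))
    (fun y hy hy0 ↦ sub_eq_zero.2 (h.eq_ratio_smul h' hy hy0 (hw y hy))) hx h0 hX
  rw [fderiv_fun_sub dη (df.fun_smul dξ), fderiv_fun_smul df dξ] at this
  simp only [sub_apply, add_apply, smul_apply, ContinuousLinearMap.smulRight_apply] at this
  rw [sub_eq_zero.1 this, add_comm]

/-- Leibniz rule for `∇_ξ (f ξ)`, legitimate because `ξ` is tangent and `η = f ξ` holds along the
horizon. -/
theorem gravity_eq_ratio (hw : ∀ x ∈ U, G x (ξ x) w ≠ 0) (hx : x ∈ U) (h0 : ψ x = 0) :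
    gravity G η ξ w x =
      fderiv ℝ (ratio G η ξ w) x (ξ x) + ratio G η ξ w x * gravity G ξ ξ w x := by
  have e := h.fderiv_eq_ratio h' hw hx h0 (h.tangent x hx h0)
  have hwx := hw x hx
  simp only [gravity]
  rw [h'.killing.curl_eq h.metric hx, h.killing.curl_eq h.metric hx, e]
  simp only [chris]
  rw [h.eq_ratio_smul h' hx h0 hwx]
  simp
  field_simp
  ring

/-- The surface gravities of two Killing fields of the same horizon. -/
theorem fderiv_gravity_eq_ratio (hw : ∀ x ∈ U, G x (ξ x) w ≠ 0) (hx : x ∈ U) (h0 : ψ x = 0)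
    {X : E} (hX : fderiv ℝ ψ x X = 0) :
    fderiv ℝ (gravity G η ξ w) x X = ratio G η ξ w x * fderiv ℝ (gravity G ξ ξ w) x X := by
  set c := ratio G η ξ w x with hc
  have hG := h.metric
  -- With the factor frozen at its value at `x`, `η - c ξ` is still Killing and vanishes at `x`, so
  -- its gravity is critical there; gravity is linear in the field.
  have hζ := h.killing.sub_smul h'.killing hG c
  have e := h.fderiv_gravity_eq_zero hζ hx h0
    (sub_eq_zero.2 (h.eq_ratio_smul h' hx h0 (hw x hx)))
    (fun Y hY ↦ by
      rw [h.killing.curl_sub_smul h'.killing hG c hx, h.curl_eq_zero h' hx h0 hY,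
        h.curl_eq_zero h hx h0 hY]
      simp) (hw x hx) hX
  have dη := differentiableAt_of_mem hG.isOpen (contDiffOn_gravity hG h'.killing h.killing hw) hx
  have dξ := differentiableAt_of_mem hG.isOpen (contDiffOn_gravity hG h.killing h.killing hw) hx
  rw [fderiv_eq_of_eqOn (f₂ := fun y ↦ gravity G η ξ w y - c * gravity G ξ ξ w y) hG.isOpen
    (fun y hy ↦ gravity_sub_smul hG h'.killing h.killing c hy) hx,
    fderiv_fun_sub dη (dξ.const_mul c), fderiv_const_mul dξ] at e
  simpa [sub_eq_zero] using e

omit h h' [CompleteSpace E] in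
theorem fderiv_tangentField (x u : E) : fderiv ℝ ψ x (tangentField ψ w u x) = 0 := by
  simp [tangentField]; ring

omit h' [CompleteSpace E] in
theorem contDiffOn_tangentField (u : E) : ContDiffOn ℝ ∞ (tangentField ψ w u) U := by
  have sψ := contDiffOn_fderiv h.metric.isOpen h.smooth
  exact ((sψ.clm_apply contDiffOn_const).smul contDiffOn_const).sub
    ((sψ.clm_apply contDiffOn_const).smul contDiffOn_const)

/-- This is `df ∧ dk = 0`, the exterior derivative of `dl = f dk`, evaluated on `ξ` and a tangent
field `Y` and combined with `ξ(k) = 0`. -/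
theorem fderiv_ratio_mul (hw : ∀ x ∈ U, G x (ξ x) w ≠ 0) (hx : x ∈ U) (h0 : ψ x = 0) (u : E) :
    fderiv ℝ (ratio G η ξ w) x (ξ x) * fderiv ℝ (gravity G ξ ξ w) x (tangentField ψ w u x) = 0 := by
  have hG := h.metric
  have hU := hG.isOpen
  set Y := tangentField ψ w u with hYdef
  set f := ratio G η ξ w with hf
  set k := gravity G ξ ξ w with hk
  set l := gravity G η ξ w with hl
  have sY : ContDiffOn ℝ ∞ Y U := h.contDiffOn_tangentField u
  have sf : ContDiffOn ℝ ∞ f U := contDiffOn_ratio hG h'.killing h.killing hw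
  have sk : ContDiffOn ℝ ∞ k U := contDiffOn_gravity hG h.killing h.killing hw
  have sl : ContDiffOn ℝ ∞ l U := contDiffOn_gravity hG h'.killing h.killing hw
  have sξ := h.killing.smooth
  have sk' := contDiffOn_fderiv hU sk
  have sl' := contDiffOn_fderiv hU sl
  have sψ' := contDiffOn_fderiv hU h.smooth
  have expand {m : E → ℝ} (hm : ContDiffOn ℝ ∞ m U) {V : E → E} (hV : ContDiffOn ℝ ∞ V U) (Z : E) :
      fderiv ℝ (fun y ↦ fderiv ℝ m y (V y)) x Z =
        fderiv ℝ (fderiv ℝ m) x Z (V x) + fderiv ℝ m x (fderiv ℝ V x Z) := by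
    rw [fderiv_clm_apply (differentiableAt_of_mem hU (contDiffOn_fderiv hU hm) hx)
      (differentiableAt_of_mem hU hV hx)]
    simp [add_comm]
  have hξt := h.tangent x hx h0
  have hYt : fderiv ℝ ψ x (Y x) = 0 := fderiv_tangentField x u
  have r0 := h.fderiv_eq_zero (f := fun y ↦ fderiv ℝ l y (Y y) - f y * fderiv ℝ k y (Y y))
    ((sl'.clm_apply sY).sub (sf.mul (sk'.clm_apply sY)))
    (fun y hy hy0 ↦ sub_eq_zero.2
      (h.fderiv_gravity_eq_ratio h' hw hy hy0 (fderiv_tangentField y u))) hx h0 hξt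
  have r1 := h.fderiv_eq_zero (f := fun y ↦ fderiv ℝ k y (ξ y)) (sk'.clm_apply sξ)
    (fun y hy hy0 ↦ h.fderiv_gravity_self hy hy0 (hw y hy)) hx h0 hYt
  have r2 := h.fderiv_eq_zero (f := fun y ↦ fderiv ℝ l y (ξ y)) (sl'.clm_apply sξ)
    (fun y hy hy0 ↦ by
      rw [h.fderiv_gravity_eq_ratio h' hw hy hy0 (h.tangent y hy hy0),
        h.fderiv_gravity_self hy hy0 (hw y hy), mul_zero]) hx h0 hYt
  have r3 := h.fderiv_eq_zero (f := fun y ↦ fderiv ℝ ψ y (ξ y)) (sψ'.clm_apply sξ)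
    h.tangent hx h0 hYt
  have r4 := h.fderiv_eq_zero (f := fun y ↦ fderiv ℝ ψ y (Y y)) (sψ'.clm_apply sY)
    (fun y _ _ ↦ fderiv_tangentField y u) hx h0 hξt
  have d1 := differentiableAt_of_mem hU (sl'.clm_apply sY) hx
  have d2 := differentiableAt_of_mem hU sf hx
  have d3 := differentiableAt_of_mem hU (sk'.clm_apply sY) hx
  rw [fderiv_fun_sub d1 (d2.fun_mul d3), fderiv_fun_mul d2 d3] at r0
  simp only [sub_apply, add_apply, smul_apply, smul_eq_mul, expand sl sY, expand sk sY] at r0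
  rw [expand sk sξ] at r1
  rw [expand sl sξ] at r2
  rw [expand h.smooth sξ] at r3
  rw [expand h.smooth sY] at r4
  rw [fderiv_fderiv_symm hU sl hx, fderiv_fderiv_symm hU sk hx] at r0
  rw [fderiv_fderiv_symm hU h.smooth hx] at r4
  -- The bracket `[ξ, Y]` is tangent, so `dl = f dk` applies to it and removes the first-order terms
  -- left by commuting derivatives.
  have hZ : fderiv ℝ ψ x (fderiv ℝ Y x (ξ x) - fderiv ℝ ξ x (Y x)) = 0 := by
    rw [map_sub]; linarith
  have r5 := h.fderiv_gravity_eq_ratio h' hw hx h0 hZ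
  rw [map_sub, map_sub] at r5
  linear_combination (-r0) + r5 + r2 - f x * r1

/-- If the first jet of no combination `η - c ξ` vanishes, then the surface gravity of `ξ` is
constant along the horizon. -/
theorem fderiv_gravity_eq_zero_of_independent (hw : ∀ x ∈ U, G x (ξ x) w ≠ 0)
    (hind : ∀ q ∈ U, ∀ c : ℝ, η q = c • ξ q → fderiv ℝ η q ≠ c • fderiv ℝ ξ q)
    (hx : x ∈ U) (h0 : ψ x = 0) {X : E} (hX : fderiv ℝ ψ x X = 0) :
    fderiv ℝ (gravity G ξ ξ w) x X = 0 := by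
  by_contra hne
  have hG := h.metric
  have hU := hG.isOpen
  set f := ratio G η ξ w with hf
  set k := gravity G ξ ξ w with hk
  have sf : ContDiffOn ℝ ∞ f U := contDiffOn_ratio hG h'.killing h.killing hw
  have sk : ContDiffOn ℝ ∞ k U := contDiffOn_gravity hG h.killing h.killing hw
  have sl := contDiffOn_gravity hG h'.killing h.killing hw
  have sY : ContDiffOn ℝ ∞ (tangentField ψ w X) U := h.contDiffOn_tangentField X
  set K : E → ℝ := fun y ↦ fderiv ℝ k y (tangentField ψ w X y) with hK
  have sK : ContDiffOn ℝ ∞ K U := (contDiffOn_fderiv hU sk).clm_apply sY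
  -- At `x` the tangent field is `dψ(w) X`, and `dψ(w) ≠ 0` because `w` is transversal.
  have hKx : K x ≠ 0 := by
    obtain ⟨c, hc0, hc⟩ := h.exists_normal hx h0
    have := hw x hx
    rw [hc] at this
    have hψw := right_ne_zero_of_mul this
    simp only [hK, tangentField, hX, zero_smul, sub_zero, map_smul, smul_eq_mul]
    exact mul_ne_zero hψw hne
  have hV : IsOpen (U ∩ K ⁻¹' {0}ᶜ) := sK.continuousOn.isOpen_inter_preimage hU
    isOpen_compl_singleton
  set V := U ∩ K ⁻¹' {0}ᶜ with hVdef
  have hVU : V ⊆ U := inter_subset_left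
  have hxV : x ∈ V := ⟨hx, hKx⟩
  have hV1 := h.mono hV hVU
  have key (y : E) (hy : y ∈ V) (hy0 : ψ y = 0) : gravity G η ξ w y = f y * k y := by
    have := (mul_eq_zero.1 (h.fderiv_ratio_mul h' hw (hVU hy) hy0 X)).resolve_right hy.2
    rw [h.gravity_eq_ratio h' hw (hVU hy) hy0, this, zero_add]
  -- If `k` vanished on the horizon inside `V`, so would its derivative along `X` at `x`.
  obtain ⟨q, hqV, hq0, hqk⟩ : ∃ q ∈ V, ψ q = 0 ∧ k q ≠ 0 := by
    by_contra! hc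
    exact hne (hV1.fderiv_eq_zero (sk.mono hVU) hc hxV h0 hX)
  have hq := hVU hqV
  -- Differentiating `l = f k` and subtracting `dl = f dk` leaves `k df = 0`.
  have hfq {Z : E} (hZ : fderiv ℝ ψ q Z = 0) : fderiv ℝ f q Z = 0 := by
    have e := hV1.fderiv_eq_zero (f := fun y ↦ gravity G η ξ w y - f y * k y)
      ((sl.sub (sf.mul sk)).mono hVU) (fun y hy hy0 ↦ sub_eq_zero.2 (key y hy hy0)) hqV hq0 hZ
    have d1 := differentiableAt_of_mem hU sl hq
    have d2 := differentiableAt_of_mem hU sf hq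
    have d3 := differentiableAt_of_mem hU sk hq
    rw [fderiv_fun_sub d1 (d2.fun_mul d3), fderiv_fun_mul d2 d3] at e
    simp only [sub_apply, add_apply, smul_apply, smul_eq_mul] at e
    rw [h.fderiv_gravity_eq_ratio h' hw hq hq0 hZ] at e
    have : k q * fderiv ℝ f q Z = 0 := by linarith
    exact (mul_eq_zero.1 this).resolve_left hqk
  have hηq := h.eq_ratio_smul h' hq hq0 (hw q hq)
  refine hind q hq (f q) hηq ?_
  set A := fderiv ℝ η q - f q • fderiv ℝ ξ q with hA
  have hskew (a b : E) : G q (A a) b + G q a (A b) = 0 := by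
    have e1 := h.killing.killing q hq a b
    have e2 := h'.killing.killing q hq a b
    rw [hηq] at e2
    simp [hA] at e2 ⊢
    linear_combination e2 - f q * e1
  have hAt (Z : E) (hZ : fderiv ℝ ψ q Z = 0) : A Z = 0 := by
    simp only [hA, sub_apply, smul_apply]
    rw [h.fderiv_eq_ratio h' hw hq hq0 hZ, hfq hZ]
    simp [hf]
  -- As `A` kills tangent vectors, skewness makes `A w` normal, hence a multiple of `ξ`. Skewness
  -- also gives `G(A w, w) = 0`, whereas `G(ξ, w) ≠ 0`, so the multiple is zero.
  have hAw : A w = 0 := by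
    obtain ⟨c, hc⟩ := h.exists_eq_mul hq hq0 (M := G q (A w)) fun Z hZ ↦ by
      have := hskew w Z
      rwa [hAt Z hZ, map_zero, add_zero] at this
    refine hG.nondeg q hq _ fun z ↦ ?_
    have h1 := hskew w w
    rw [hG.symm q hq w, ← two_mul, hc] at h1
    have hc0 : c = 0 := by simpa [hw q hq] using h1
    rw [hc, hc0, zero_mul]
  obtain ⟨c, hc0, hc⟩ := h.exists_normal hq hq0
  have hψw : fderiv ℝ ψ q w ≠ 0 := by
    have := hw q hq
    rw [hc] at this
    exact right_ne_zero_of_mul this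
  rw [← sub_eq_zero]
  ext1 z
  have := hAt (tangentField ψ w z q) (fderiv_tangentField q z)
  rw [tangentField, map_sub, map_smul, map_smul, hAw, smul_zero, sub_zero] at this
  exact (smul_eq_zero.1 this).resolve_left hψw

end CoordHorizon

/-! ### Extension of the surface gravity across zeros of the Killing field -/

/-- The surface gravity of `ζ` with respect to the conormal `dψ`, tested against `w`. -/
noncomputable def conormalGravity (G : E → E →L[ℝ] E →L[ℝ] ℝ) (ζ : E → E) (ψ : E → ℝ) (w x : E) :
    ℝ := curl G ζ x ((G x).inverse (fderiv ℝ ψ x)) w / (2 * fderiv ℝ ψ x w)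

variable [FiniteDimensional ℝ E]

theorem contDiffOn_conormalGravity (hG : CoordMetric U G) (hξ : CoordKilling U G ξ)
    (hψ : ContDiffOn ℝ ∞ ψ U) (hw : ∀ x ∈ U, fderiv ℝ ψ x w ≠ 0) :
    ContDiffOn ℝ ∞ (conormalGravity G ξ ψ w) U := by
  have sψ := contDiffOn_fderiv hG.isOpen hψ
  exact (contDiffOn_curl hG hξ (hG.contDiffOn_inverse.clm_apply sψ) contDiffOn_const).div
    (contDiffOn_const.mul (sψ.clm_apply contDiffOn_const))
    fun x hx ↦ mul_ne_zero two_ne_zero (hw x hx)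

/-- The quotient is homogeneous of degree zero in the normal, so the gradient of `ψ` may replace
`ξ`. Unlike `ξ`, the gradient does not vanish where `dψ ≠ 0`. -/
theorem conormalGravity_eq (hG : CoordMetric U G) (hx : x ∈ U) {c : ℝ} (hc0 : c ≠ 0)
    (hc : ∀ z, G x (ξ x) z = c * fderiv ℝ ψ x z) (ζ : E → E) (w : E) :
    conormalGravity G ζ ψ w x = gravity G ζ ξ w x := by
  have hν : (G x).inverse (fderiv ℝ ψ x) = c⁻¹ • ξ x := by
    rw [(hG.isInvertible hx).inverse_apply_eq]
    ext z
    simp [hc, hc0]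
  have : curl G ζ x (c⁻¹ • ξ x) w = c⁻¹ * curl G ζ x (ξ x) w := by
    simp [curl]; ring
  rw [conormalGravity, gravity, hν, hc, this]
  field_simp

/-- If the points of the hypersurface `{ψ = 0}` near which it is a horizon of two independent
Killing fields are dense, then the surface gravity is locally constant. -/
theorem exists_eventually_gravity_eq (hG : CoordMetric U G) (hξ : CoordKilling U G ξ)
    (hψ : ContDiffOn ℝ ∞ ψ U) {S : Set E}
    (hS : ∀ s ∈ S, s ∈ U → ∃ V, IsOpen V ∧ s ∈ V ∧ CoordHorizon V G ψ ξ ∧ CoordHorizon V G ψ η)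
    (hS0 : ∀ s ∈ S, s ∈ U → ψ s = 0)
    (hind : ∀ q ∈ U, ∀ c : ℝ, η q = c • ξ q → fderiv ℝ η q ≠ c • fderiv ℝ ξ q)
    (hdense : ∀ x ∈ U, ψ x = 0 → x ∈ closure S) {p : E} (hp : p ∈ U) (hp0 : ψ p = 0)
    (hψ' : fderiv ℝ ψ p ≠ 0) :
    ∃ c : ℝ, ∀ᶠ x in nhds p, ψ x = 0 → ξ x ≠ 0 →
      (∀ X, fderiv ℝ ψ x X = 0 → G x (ξ x) X = 0) →
      ∀ κ : ℝ, (∀ z, curl G ξ x (ξ x) z = 2 * κ * G x (ξ x) z) → κ = c := by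
  obtain ⟨w, hw⟩ : ∃ w, fderiv ℝ ψ p w ≠ 0 := by
    by_contra! hc
    exact hψ' (ContinuousLinearMap.ext hc)
  have sψ := contDiffOn_fderiv hG.isOpen hψ
  have sψw : ContDiffOn ℝ ∞ (fun x ↦ fderiv ℝ ψ x w) U := sψ.clm_apply contDiffOn_const
  have hO := sψw.continuousOn.isOpen_inter_preimage hG.isOpen (isOpen_compl_singleton (x := (0 : ℝ)))
  set O := U ∩ (fun x ↦ fderiv ℝ ψ x w) ⁻¹' {0}ᶜ with hOdef
  have hOU : O ⊆ U := inter_subset_left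
  have hOw (x : E) (hx : x ∈ O) : fderiv ℝ ψ x w ≠ 0 := hx.2
  set k := conormalGravity G ξ ψ w with hk
  have sk : ContDiffOn ℝ ∞ k O := contDiffOn_conormalGravity (hG.mono hO hOU) (hξ.mono hOU)
    (hψ.mono hOU) hOw
  have sk' := contDiffOn_fderiv hO sk
  have onS (s : E) (hs : s ∈ S) (hsO : s ∈ O) (X : E) (hX : fderiv ℝ ψ s X = 0) :
      fderiv ℝ k s X = 0 := by
    obtain ⟨V, hV, hsV, hV1, hV2⟩ := hS s hs (hOU hsO)
    have hs0 := hS0 s hs (hOU hsO)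
    have sG : ContinuousOn (fun x ↦ G x (ξ x) w) U :=
      ((hG.smooth.clm_apply hξ.smooth).clm_apply contDiffOn_const).continuousOn
    have hW := (sG.isOpen_inter_preimage hG.isOpen (isOpen_compl_singleton (x := (0 : ℝ)))).inter
      (hV.inter hO)
    set W := U ∩ (fun x ↦ G x (ξ x) w) ⁻¹' {0}ᶜ ∩ (V ∩ O) with hWdef
    have hWV : W ⊆ V := fun x hx ↦ hx.2.1
    have hWO : W ⊆ O := fun x hx ↦ hx.2.2
    have hWw (x : E) (hx : x ∈ W) : G x (ξ x) w ≠ 0 := hx.1.2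
    have hsW : s ∈ W := by
      refine ⟨⟨hOU hsO, ?_⟩, hsV, hsO⟩
      obtain ⟨c, hc0, hc⟩ := hV1.exists_normal hsV hs0
      simp only [mem_preimage, mem_compl_iff, mem_singleton_iff, hc]
      exact mul_ne_zero hc0 (hOw s hsO)
    have hW1 := hV1.mono hW hWV
    have hW2 := hV2.mono hW hWV
    have sg := contDiffOn_gravity hW1.metric hW1.killing hW1.killing hWw
    have e := hW1.fderiv_eq_zero (f := fun x ↦ k x - gravity G ξ ξ w x)
      ((sk.mono hWO).sub sg)
      (fun y hy hy0 ↦ by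
        obtain ⟨c, hc0, hc⟩ := hW1.exists_normal hy hy0
        rw [hk, conormalGravity_eq hG (hOU (hWO hy)) hc0 hc, sub_self]) hsW hs0 hX
    rw [fderiv_fun_sub (differentiableAt_of_mem hO sk hsO) (differentiableAt_of_mem hW sg hsW),
      sub_apply, hW1.fderiv_gravity_eq_zero_of_independent hW2 hWw
        (fun q hq ↦ hind q (hOU (hWO hq))) hsW hs0 hX, sub_zero] at e
    exact e
  -- Extend `X` to the tangent field through it: the derivative of `k` along this field is
  -- continuous and vanishes on the dense set `S`, hence at `x`.
  have onO (x : E) (hx : x ∈ O) (hx0 : ψ x = 0) (X : E) (hX : fderiv ℝ ψ x X = 0) :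
      fderiv ℝ k x X = 0 := by
    set K : E → ℝ := fun y ↦ fderiv ℝ k y (tangentField ψ w X y) with hK
    have cK : ContinuousAt K x := by
      refine ContinuousOn.continuousAt ?_ (hO.mem_nhds hx)
      have sψO := sψ.mono hOU
      exact (sk'.clm_apply (((sψO.clm_apply contDiffOn_const).smul contDiffOn_const).sub
        ((sψO.clm_apply contDiffOn_const).smul contDiffOn_const))).continuousOn
    have hcl : x ∈ closure (S ∩ O) := by
      rw [mem_closure_iff_nhds]
      intro t ht
      obtain ⟨y, hy1, hy2⟩ := mem_closure_iff_nhds.1 (hdense x (hOU hx) hx0) (t ∩ O)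
        (Filter.inter_mem ht (hO.mem_nhds hx))
      exact ⟨y, hy1.1, hy2, hy1.2⟩
    have hKx : K x = 0 := by
      have := cK.continuousWithinAt.mem_closure_image hcl (f := K)
      refine closure_minimal (t := {0}) ?_ isClosed_singleton this
      rintro _ ⟨y, ⟨hyS, hyO⟩, rfl⟩
      exact onS y hyS hyO _ (CoordHorizon.fderiv_tangentField y X)
    simp only [hK, tangentField, hX, zero_smul, sub_zero, map_smul, smul_eq_mul] at hKx
    exact (mul_eq_zero.1 hKx).resolve_left (hOw x hx)
  have hpO : p ∈ O := ⟨hp, hw⟩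
  refine ⟨k p, ?_⟩
  filter_upwards [eventually_eq_of_fderiv_eq_zero hO hpO (hψ.mono hOU) sk hψ' hp0 onO,
    hO.mem_nhds hpO] with x hx hxO hx0 hξx hn κ hκ
  rw [← hx hx0]
  have hψx : fderiv ℝ ψ x ≠ 0 := fun h0 ↦ hOw x hxO (by simp [h0])
  obtain ⟨c, hc⟩ := exists_eq_mul_of_ker_le hψx hn
  have hc0 : c ≠ 0 := by
    rintro rfl
    exact hξx (hG.nondeg x (hOU hxO) _ fun w ↦ by simp [hc])
  rw [hk, conormalGravity_eq hG (hOU hxO) hc0 hc]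
  refine (CoordHorizon.gravity_eq hκ ?_).symm
  rw [hc]
  exact mul_ne_zero hc0 (hOw x hxO)

end TwoHorizons

/-! ### Passage to charts -/

section Charts

set_option maxSynthPendingDepth 3

variable {n : ℕ} {M : Type*} [TopologicalSpace M]
  [ChartedSpace (EuclideanSpace ℝ (Fin (n + 1))) M]

/-- The inverse of the chart at `p`. -/
noncomputable def param (p : M) : EuclideanSpace ℝ (Fin (n + 1)) → M := (extChartAt (𝓡 (n + 1)) p).symm

variable (n) in
/-- The domain of the inverse of the chart at `p`. -/
def dom (p : M) : Set (EuclideanSpace ℝ (Fin (n + 1))) := (extChartAt (𝓡 (n + 1)) p).target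

/-- The differential of the inverse of the chart at `p`. -/
noncomputable def dparam (p : M) (x : EuclideanSpace ℝ (Fin (n + 1))) : EuclideanSpace ℝ (Fin (n + 1)) →L[ℝ] TangentSpace (𝓡 (n + 1)) (param p x) :=
  mfderiv 𝓘(ℝ, EuclideanSpace ℝ (Fin (n + 1))) (𝓡 (n + 1)) (param p) x

/-- A vector field in the chart at `p`. -/
noncomputable def pullField (p : M) (X : VField n M) : EuclideanSpace ℝ (Fin (n + 1)) → EuclideanSpace ℝ (Fin (n + 1)) :=
  VectorField.mpullback 𝓘(ℝ, EuclideanSpace ℝ (Fin (n + 1))) (𝓡 (n + 1)) (param p) X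

/-- A vector field which is constant in the chart at `p`. -/
noncomputable def pushField (p : M) (v : EuclideanSpace ℝ (Fin (n + 1))) : VField n M :=
  VectorField.mpullback (𝓡 (n + 1)) 𝓘(ℝ, EuclideanSpace ℝ (Fin (n + 1))) (extChartAt (𝓡 (n + 1)) p) (fun _ ↦ v)

theorem isOpen_dom (p : M) : IsOpen (dom n p) := isOpen_extChartAt_target p

theorem mem_source_of_mem_dom {p : M} {x : EuclideanSpace ℝ (Fin (n + 1))} (hx : x ∈ dom n p) :
    param p x ∈ (extChartAt (𝓡 (n + 1)) p).source :=
  (extChartAt (𝓡 (n + 1)) p).map_target hx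

variable [IsManifold (𝓡 (n + 1)) ∞ M]

/-- A smooth vector field at the point `q`. -/
def SmoothAt (X : VField n M) (q : M) : Prop :=
  ContMDiffAt (𝓡 (n + 1)) (𝓡 (n + 1)).tangent ∞
    (fun q ↦ (⟨q, X q⟩ : TangentBundle (𝓡 (n + 1)) M)) q

theorem SmoothAt.diffAt {X : VField n M} {q : M} (h : SmoothAt X q) : DiffAt X q :=
  ContMDiffAt.mdifferentiableAt h (by simp)

variable {p : M} {x : EuclideanSpace ℝ (Fin (n + 1))}

theorem contMDiffAt_param (hx : x ∈ dom n p) :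
    ContMDiffAt 𝓘(ℝ, EuclideanSpace ℝ (Fin (n + 1))) (𝓡 (n + 1)) ∞ (param p) x :=
  (contMDiffOn_extChartAt_symm p).contMDiffAt ((isOpen_dom p).mem_nhds hx)

theorem continuousAt_param (hx : x ∈ dom n p) : ContinuousAt (param p) x :=
  (contMDiffAt_param hx).continuousAt

theorem isInvertible_dparam (hx : x ∈ dom n p) : (dparam p x).IsInvertible := by
  have : IsManifold (𝓡 (n + 1)) 1 M := IsManifold.of_le (n := ∞) (by simp)
  have := isInvertible_mfderivWithin_extChartAt_symm (I := 𝓡 (n + 1)) hx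
  rw [ModelWithCorners.range_eq_univ, mfderivWithin_univ] at this
  exact this

theorem dparam_pullField (hx : x ∈ dom n p) (X : VField n M) :
    dparam p x (pullField p X x) = X (param p x) :=
  (isInvertible_dparam hx).self_apply_inverse _

theorem dparam_injective (hx : x ∈ dom n p) : Function.Injective (dparam (n := n) p x) := by
  obtain ⟨e, he⟩ := isInvertible_dparam hx
  rw [← he]
  exact e.injective

theorem dparam_surjective (hx : x ∈ dom n p) : Function.Surjective (dparam (n := n) p x) := by
  obtain ⟨e, he⟩ := isInvertible_dparam hx
  rw [← he]
  exact e.surjective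

theorem pullField_pushField (hx : x ∈ dom n p) (v : EuclideanSpace ℝ (Fin (n + 1))) : pullField p (pushField (M := M) p v) x = v := by
  have : IsManifold (𝓡 (n + 1)) 1 M := IsManifold.of_le (n := ∞) (by simp)
  apply dparam_injective hx
  rw [dparam_pullField hx]
  have h := mfderiv_extChartAt_comp_mfderivWithin_extChartAt_symm (I := 𝓡 (n + 1)) hx
  rw [ModelWithCorners.range_eq_univ, mfderivWithin_univ] at h
  have hi := isInvertible_mfderiv_extChartAt (I := 𝓡 (n + 1)) (mem_source_of_mem_dom hx)
  refine (hi.inverse_apply_eq).2 ?_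
  exact (congrArg (fun L : EuclideanSpace ℝ (Fin (n + 1)) →L[ℝ] EuclideanSpace ℝ (Fin (n + 1)) ↦ L v) h).symm

theorem smoothAt_pushField (hx : x ∈ dom n p) (v : EuclideanSpace ℝ (Fin (n + 1))) :
    SmoothAt (pushField (M := M) p v) (param p x) := by
  have : IsManifold (𝓡 (n + 1)) 1 M := IsManifold.of_le (n := ∞) (by simp)
  have hs := mem_source_of_mem_dom hx
  refine ContMDiffAt.mpullback_vectorField_preimage (n := ∞)
    (contMDiffAt_vectorSpace_iff_contDiffAt.2 contDiffAt_const) (contMDiffAt_extChartAt' ?_)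
    (isInvertible_mfderiv_extChartAt hs) (by simp)
  rwa [extChartAt_source] at hs

theorem contDiffAt_pullField {X : VField n M} (hx : x ∈ dom n p) (hX : SmoothAt X (param p x)) :
    ContDiffAt ℝ ∞ (pullField p X) x := by
  have : IsManifold (𝓡 (n + 1)) 1 M := IsManifold.of_le (n := ∞) (by simp)
  exact contMDiffAt_vectorSpace_iff_contDiffAt.1
    (ContMDiffAt.mpullback_vectorField_preimage (n := ∞) hX (contMDiffAt_param hx)
      (isInvertible_dparam hx) (by simp))

theorem fderiv_comp_param {f : M → ℝ} (hx : x ∈ dom n p)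
    (hf : MDifferentiableAt (𝓡 (n + 1)) 𝓘(ℝ, ℝ) f (param p x)) (v : EuclideanSpace ℝ (Fin (n + 1))) :
    fderiv ℝ (fun y ↦ f (param p y)) x v = mvfderiv (𝓡 (n + 1)) f (param p x) (dparam p x v) := by
  refine Eq.trans ?_
    (mvfderiv_comp_apply x hf ((contMDiffAt_param hx).mdifferentiableAt (by simp)) v)
  rw [mvfderiv, mfderiv_eq_fderiv]
  rfl

theorem along_eq {f : M → ℝ} (hx : x ∈ dom n p)
    (hf : MDifferentiableAt (𝓡 (n + 1)) 𝓘(ℝ, ℝ) f (param p x)) (X : VField n M) :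
    along X f (param p x) = fderiv ℝ (fun y ↦ f (param p y)) x (pullField p X x) := by
  rw [fderiv_comp_param hx hf, dparam_pullField hx, along]

theorem pullField_bracket (hx : x ∈ dom n p) {X Y : VField n M} (hX : DiffAt X (param p x))
    (hY : DiffAt Y (param p x)) : pullField p (bracket X Y) x =
      fderiv ℝ (pullField p Y) x (pullField p X x)
        - fderiv ℝ (pullField p X) x (pullField p Y x) := by
  have : IsManifold (𝓡 (n + 1)) (minSmoothness ℝ 2) M := by
    rw [minSmoothness_of_isRCLikeNormedField]
    exact IsManifold.of_le (n := ∞) (WithTop.coe_le_coe.2 le_top)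
  have h := VectorField.mpullback_mlieBracket (n := ∞) hX hY (contMDiffAt_param hx)
    (by rw [minSmoothness_of_isRCLikeNormedField]; exact WithTop.coe_le_coe.2 le_top)
  refine h.trans ?_
  rw [← VectorField.mlieBracketWithin_univ, VectorField.mlieBracketWithin_eq_lieBracketWithin]
  exact congrFun VectorField.lieBracketWithin_univ x

/-- The metric in the chart at `p`. -/
noncomputable def pullMetric (g : LorentzianMetric n M) (p : M) (x : EuclideanSpace ℝ (Fin (n + 1))) : EuclideanSpace ℝ (Fin (n + 1)) →L[ℝ] EuclideanSpace ℝ (Fin (n + 1)) →L[ℝ] ℝ :=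
  ContinuousLinearMap.bilinearComp (E := EuclideanSpace ℝ (Fin (n + 1))) (F := EuclideanSpace ℝ (Fin (n + 1))) (G := ℝ) (g.val (param p x)) (dparam p x)
    (dparam p x)

theorem pullMetric_apply (g : LorentzianMetric n M) (p : M) (x v w : EuclideanSpace ℝ (Fin (n + 1))) :
    pullMetric g p x v w = g.val (param p x) (dparam p x v) (dparam p x w) := rfl

theorem pullMetric_pullField (g : LorentzianMetric n M) (hx : x ∈ dom n p) (X Y : VField n M) :
    pullMetric g p x (pullField p X x) (pullField p Y x) = g.pairing X Y (param p x) := by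
  rw [pullMetric_apply, dparam_pullField hx, dparam_pullField hx, LorentzianMetric.pairing]

theorem contMDiffAt_pairing (g : LorentzianMetric n M) {X Y : VField n M} {q : M}
    (hX : SmoothAt X q) (hY : SmoothAt Y q) :
    ContMDiffAt (𝓡 (n + 1)) 𝓘(ℝ, ℝ) ∞ (g.pairing X Y) q := by
  have h := ContMDiffAt.clm_bundle_apply₂ (F₁ := EuclideanSpace ℝ (Fin (n + 1))) (F₂ := EuclideanSpace ℝ (Fin (n + 1))) (F₃ := ℝ)
    (E₁ := TangentSpace (𝓡 (n + 1)) (M := M)) (E₂ := TangentSpace (𝓡 (n + 1)) (M := M))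
    (E₃ := Bundle.Trivial M ℝ) (b := fun q ↦ q) (ψ := fun q ↦ g.val q) (g.contMDiff q) hX hY
  exact (Bundle.contMDiffAt_totalSpace.1 h).2

theorem mdifferentiableAt_pairing (g : LorentzianMetric n M) {X Y : VField n M} {q : M}
    (hX : SmoothAt X q) (hY : SmoothAt Y q) :
    MDifferentiableAt (𝓡 (n + 1)) 𝓘(ℝ, ℝ) (g.pairing X Y) q :=
  (contMDiffAt_pairing g hX hY).mdifferentiableAt (by simp)

theorem coordMetric (g : LorentzianMetric n M) (p : M) : CoordMetric (dom n p) (pullMetric g p) := by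
  refine ⟨isOpen_dom p, ?_, fun x _ v w ↦ g.symm _ _ _, fun x hx v h ↦ ?_⟩
  · refine contDiffOn_clm_apply.2 fun v ↦ contDiffOn_clm_apply.2 fun w ↦ ?_
    have : EqOn (fun x ↦ pullMetric g p x v w)
        (fun x ↦ g.pairing (pushField p v) (pushField p w) (param p x)) (dom n p) := fun x hx ↦ by
      simp only [← pullMetric_pullField g hx, pullField_pushField hx]
    refine ContDiffOn.congr (fun x hx ↦ ?_) this
    exact (contMDiffAt_iff_contDiffAt.1 ((contMDiffAt_pairing g (smoothAt_pushField hx v)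
      (smoothAt_pushField hx w)).comp x (contMDiffAt_param hx))).contDiffWithinAt
  · apply dparam_injective hx
    rw [map_zero]
    refine g.eq_of_forall fun z ↦ ?_
    obtain ⟨w, rfl⟩ := dparam_surjective hx z
    rw [map_zero, zero_apply]
    exact h w

/-- It suffices to test `ℒ_ξ g = 0` on fields constant in the chart, whose bracket with `ξ` is `-D
ξ` applied to the constant. -/
theorem coordKilling {g : LorentzianMetric n M} {ξ : VField n M} (hξ : IsKilling g ξ) (p : M) :
    CoordKilling (dom n p) (pullMetric g p) (pullField p ξ) := by
  have hs : ContDiffOn ℝ ∞ (pullField p ξ) (dom n p) := fun x hx ↦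
    (contDiffAt_pullField hx (hξ.smooth (param p x))).contDiffWithinAt
  refine ⟨hs, fun x hx v w ↦ ?_⟩
  have hG := coordMetric g p
  have sv := smoothAt_pushField (M := M) hx v
  have sw := smoothAt_pushField (M := M) hx w
  have sξ : SmoothAt ξ (param p x) := hξ.smooth _
  have h := hξ.lieDeriv (param p x) (pushField p v) (pushField p w) sv.diffAt sw.diffAt
  rw [along_eq hx (mdifferentiableAt_pairing g sv sw), ← pullMetric_pullField g hx,
    ← pullMetric_pullField g hx, pullField_bracket hx sξ.diffAt sv.diffAt,
    pullField_bracket hx sξ.diffAt sw.diffAt] at h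
  have e (u : EuclideanSpace ℝ (Fin (n + 1))) : fderiv ℝ (pullField p (pushField (M := M) p u)) x = 0 := by
    rw [fderiv_eq_of_eqOn (isOpen_dom p) (f₂ := fun _ ↦ u)
      (fun y hy ↦ pullField_pushField hy u) hx]
    simp
  have e' : fderiv ℝ (fun y ↦ g.pairing (pushField p v) (pushField p w) (param p y)) x =
      fderiv ℝ (fun y ↦ pullMetric g p y v w) x :=
    fderiv_eq_of_eqOn (isOpen_dom p) (fun y hy ↦ by
      simp only [← pullMetric_pullField g hy, pullField_pushField hy]) hx
  rw [e, e, e', pullField_pushField hx, pullField_pushField hx,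
    (hasFDerivAt_bilin (hG.diff hx) (differentiableAt_const v) (differentiableAt_const w)).2] at h
  simp at h
  linear_combination h

/-- With both arguments equal to a Killing field, the Koszul expression collapses to `-Z(g(ξ,ξ))`,
which is the curl of `ξ♭` on `ξ` and `Z`. -/
theorem isCovDerivAt_self_iff {g : LorentzianMetric n M} {ξ : VField n M} (hξ : IsKilling g ξ)
    (hx : x ∈ dom n p) (w : TangentSpace (𝓡 (n + 1)) (param p x)) :
    IsCovDerivAt g ξ ξ (param p x) w ↔ ∀ v, 2 * g.val (param p x) w (dparam p x v) =
      curl (pullMetric g p) (pullField p ξ) x (pullField p ξ x) v := by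
  have hG := coordMetric g p
  have sξ : SmoothAt ξ (param p x) := hξ.smooth _
  have hbr : bracket ξ ξ = 0 := by
    have : bracket ξ ξ = - bracket ξ ξ := VectorField.mlieBracket_swap
    funext q
    have h2 := congrFun this q
    have h3 : (2 : ℝ) • bracket ξ ξ q = 0 := by
      rw [two_smul]; nth_rewrite 1 [h2]; simp
    simpa using h3
  have key (Z : VField n M) (hZ : DiffAt Z (param p x)) :
      along ξ (g.pairing ξ Z) (param p x) + along ξ (g.pairing ξ Z) (param p x)
        - along Z (g.pairing ξ ξ) (param p x) + g.pairing (bracket ξ ξ) Z (param p x)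
        - g.pairing (bracket ξ Z) ξ (param p x) - g.pairing (bracket ξ Z) ξ (param p x) =
      curl (pullMetric g p) (pullField p ξ) x (pullField p ξ x) (pullField p Z x) := by
    rw [hξ.lieDeriv _ ξ Z sξ.diffAt hZ, hbr]
    have hZ' := along_eq hx (mdifferentiableAt_pairing g sξ sξ) Z
    rw [fderiv_eq_of_eqOn (isOpen_dom p) (f₂ := fun y ↦ pullMetric g p y (pullField p ξ y)
      (pullField p ξ y)) (fun y hy ↦ (pullMetric_pullField g hy ξ ξ).symm) hx,
      (coordKilling hξ p).fderiv_norm hG hx] at hZ'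
    rw [hZ']
    simp only [LorentzianMetric.pairing, g.symm _ (bracket ξ Z _) (ξ _), Pi.zero_apply, map_zero,
      zero_apply]
    ring
  constructor
  · intro h v
    have h1 := h (pushField p v) (smoothAt_pushField hx v).diffAt
    rw [key _ (smoothAt_pushField hx v).diffAt, ← dparam_pullField hx (pushField p v),
      pullField_pushField hx] at h1
    exact h1
  · intro h Z hZ
    rw [key Z hZ, ← h, dparam_pullField hx]

end Charts

/-! ### Closures and connectedness of horizons -/

section Horizons

set_option maxSynthPendingDepth 3

variable {n : ℕ} {M : Type*} [TopologicalSpace M]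
  [ChartedSpace (EuclideanSpace ℝ (Fin (n + 1))) M]

/-- A locally closed set is open in its closure. -/
theorem exists_isOpen_inter_closure {S : Set M} (hS : IsHypersurface n S) {q : M} (hq : q ∈ S) :
    ∃ V, IsOpen V ∧ q ∈ V ∧ ∀ y ∈ V, y ∈ closure S → y ∈ S := by
  obtain ⟨V, f, hqV, hf⟩ := hS q hq
  refine ⟨V, hf.isOpen, hqV, fun y hy hyS ↦ (hf.zeroSet y hy).2 ?_⟩
  have hc : ContinuousAt f y := (hf.smooth.continuousOn).continuousAt (hf.isOpen.mem_nhds hy)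
  have hcl : y ∈ closure (S ∩ V) := by
    rw [mem_closure_iff_nhds] at hyS ⊢
    intro t ht
    obtain ⟨z, hz, hzS⟩ := hyS (t ∩ V) (Filter.inter_mem ht (hf.isOpen.mem_nhds hy))
    exact ⟨z, hz.1, hzS, hz.2⟩
  have := hc.continuousWithinAt.mem_closure_image hcl
  refine closure_minimal (t := {0}) ?_ isClosed_singleton this
  rintro _ ⟨z, ⟨hzS, hzV⟩, rfl⟩
  exact (hf.zeroSet z hzV).1 hzS

theorem IsDefiningFunction.congr {S T U V : Set M} {f : M → ℝ}
    (hf : IsDefiningFunction (n := n) S U f) (hV : IsOpen V) (hVU : V ⊆ U)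
    (hST : ∀ y ∈ V, y ∈ S ↔ y ∈ T) : IsDefiningFunction (n := n) T V f :=
  ⟨hV, hf.smooth.mono hVU, fun q hq ↦ hf.submersive q (hVU hq),
    fun q hq ↦ (hST q hq).symm.trans (hf.zeroSet q (hVU hq))⟩

theorem subset_hypersurfaceInterior_closure {S : Set M} (hS : IsHypersurface n S) :
    S ⊆ hypersurfaceInterior n (closure S) := by
  intro q hq
  obtain ⟨V, hV, hqV, h⟩ := exists_isOpen_inter_closure hS hq
  obtain ⟨U, f, hqU, hf⟩ := hS q hq
  exact ⟨subset_closure hq, U ∩ V, f, ⟨hqU, hqV⟩, hf.congr (hf.isOpen.inter hV) inter_subset_left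
    fun y hy ↦ ⟨fun hyS ↦ subset_closure hyS, h y hy.2⟩⟩

/-- `S` is open in the common closure, in which `T` is dense, so `T` meets `S` near each point of
`S`. -/
theorem closure_subset_closure_inter {S T : Set M} (hS : IsHypersurface n S)
    (hST : closure S = closure T) : closure S ⊆ closure (S ∩ T) := by
  refine closure_minimal (fun q hq ↦ ?_) isClosed_closure
  obtain ⟨V, hV, hqV, h⟩ := exists_isOpen_inter_closure hS hq
  rw [mem_closure_iff_nhds]
  intro t ht
  have hqT : q ∈ closure T := hST ▸ subset_closure hq
  obtain ⟨z, hz, hzT⟩ := mem_closure_iff_nhds.1 hqT (t ∩ V)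
    (Filter.inter_mem ht (hV.mem_nhds hqV))
  exact ⟨z, hz.1, h z hz.2 (hST ▸ subset_closure hzT), hzT⟩

/-- A function on a dense subset of a preconnected set is constant if it is constant near every
point of the preconnected set. -/
theorem exists_eq_const_of_locally {X : Type*} [TopologicalSpace X] {N S : Set X}
    (hN : IsPreconnected N) (hSN : S ⊆ N) (hNS : N ⊆ closure S) (κ : S → ℝ)
    (hκ : ∀ p ∈ N, ∃ c : ℝ, ∃ O, IsOpen O ∧ p ∈ O ∧ ∀ q : S, (q : X) ∈ O → κ q = c) :
    ∃ c : ℝ, ∀ q, κ q = c := by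
  choose c O hO hpO hc using fun p : N ↦ hκ p p.2
  have : PreconnectedSpace N := Subtype.preconnectedSpace hN
  -- Overlapping neighbourhoods contain a common point of the dense set `S`, so the chosen constants
  -- agree.
  have hloc : IsLocallyConstant c := by
    rw [IsLocallyConstant.iff_eventually_eq]
    intro p
    filter_upwards [((hO p).preimage continuous_subtype_val).mem_nhds (hpO p)] with p' hp'
    obtain ⟨q, hq, hqS⟩ := mem_closure_iff_nhds.1 (hNS p'.2) _
      (((hO p).inter (hO p')).mem_nhds ⟨hp', hpO p'⟩)
    rw [← hc p ⟨q, hqS⟩ hq.1, ← hc p' ⟨q, hqS⟩ hq.2]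
  rcases isEmpty_or_nonempty S with hS | ⟨⟨q₀⟩⟩
  · exact ⟨0, fun q ↦ hS.elim q⟩
  refine ⟨c ⟨q₀, hSN q₀.2⟩, fun q ↦ ?_⟩
  rw [hc ⟨q, hSN q.2⟩ q (hpO ⟨q, hSN q.2⟩)]
  exact hloc.apply_eq_of_isPreconnected isPreconnected_univ (mem_univ _) (mem_univ _)

/-- If `K` is connected, the set lies between `K` and its closure; otherwise connectedness is part
of the definition. -/
theorem IsKillingHorizon.isPreconnected [IsManifold (𝓡 (n + 1)) ∞ M] {g : LorentzianMetric n M}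
    {ξ : VField n M} {K : Set M} (h : IsKillingHorizon g ξ K) :
    IsPreconnected (hypersurfaceInterior n (closure K)) := by
  rcases h.connected with hc | hc
  · exact hc.isPreconnected.subset_closure
      (subset_hypersurfaceInterior_closure h.nullHypersurface.hypersurface) fun q hq ↦ hq.1
  · exact hc.isPreconnected

variable [IsManifold (𝓡 (n + 1)) ∞ M]

section Lorentz

variable (g : LorentzianMetric n M) {q : M}

/-- A null vector orthogonal to a nonzero null vector is proportional to it. -/
theorem LorentzianMetric.exists_eq_smul {k v : TangentSpace (𝓡 (n + 1)) q} (hk : k ≠ 0)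
    (hkk : g.val q k k = 0) (hkv : g.val q k v = 0) (hvv : g.val q v v = 0) :
    ∃ c : ℝ, v = c • k := by
  obtain ⟨b, hb⟩ := g.signature q
  -- The form is positive definite on vectors without time component. Below, subtracting a multiple
  -- of `k` from `v` removes that component and keeps the vector null.
  have key (u : TangentSpace (𝓡 (n + 1)) q) (huu : g.val q u u = 0) (h0 : b.repr u 0 = 0) :
      u = 0 := by
    have h1 : g.val q (∑ i, b.repr u i • b i) (∑ j, b.repr u j • b j) =
        ∑ i, b.repr u i ^ 2 := by
      simp only [map_sum, map_smul, sum_apply, smul_apply, hb, smul_eq_mul, mul_ite, mul_zero,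
        Finset.sum_ite_eq', Finset.mem_univ, if_true]
      refine Finset.sum_congr rfl fun i _ ↦ ?_
      split_ifs with hi
      · subst hi; simp [h0]
      · ring
    rw [b.sum_repr u, huu] at h1
    have h2 := (Finset.sum_eq_zero_iff_of_nonneg (fun i _ ↦ sq_nonneg (b.repr u i))).1 h1.symm
    apply b.repr.injective
    ext i
    simpa using h2 i (Finset.mem_univ i)
  have hk0 : b.repr k 0 ≠ 0 := fun h ↦ hk (key k hkk h)
  refine ⟨b.repr v 0 / b.repr k 0, ?_⟩
  rw [← sub_eq_zero]
  refine key _ ?_ ?_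
  · simp [hkk, hkv, hvv, g.symm q v k]
  · simp [hk0]

end Lorentz

/-! ### Horizons in charts, rigidity and constancy -/

section Coordinates

variable {p : M} {x : EuclideanSpace ℝ (Fin (n + 1))}

theorem isOpen_dom_inter {V : Set M} (hV : IsOpen V) : IsOpen (dom n p ∩ param p ⁻¹' V) :=
  ContinuousOn.isOpen_inter_preimage
    (fun _ hx ↦ (continuousAt_param hx).continuousWithinAt) (isOpen_dom p) hV

omit [IsManifold (𝓡 (n + 1)) ∞ M] in
theorem exists_param_eq (q : M) : ∃ x ∈ dom n q, param q x = q :=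
  ⟨extChartAt (𝓡 (n + 1)) q q, mem_extChartAt_target q, extChartAt_to_inv q⟩

omit [IsManifold (𝓡 (n + 1)) ∞ M] in
/-- The inverse of the chart maps neighbourhoods to neighbourhoods. -/
theorem image_param_mem_nhds (hx : x ∈ dom n p) {B : Set (EuclideanSpace ℝ (Fin (n + 1)))}
    (hB : B ∈ nhds x) : param p '' (dom n p ∩ B) ∈ nhds (param p x) := by
  have hs : param p x ∈ (extChartAt (𝓡 (n + 1)) p).source := mem_source_of_mem_dom hx
  have hs' := hs
  rw [extChartAt_source] at hs'
  have hr : extChartAt (𝓡 (n + 1)) p (param p x) = x := (extChartAt (𝓡 (n + 1)) p).right_inv hx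
  have hc : ContinuousAt (extChartAt (𝓡 (n + 1)) p) (param p x) := continuousAt_extChartAt' hs
  filter_upwards [(isOpen_extChartAt_source p).mem_nhds hs,
    hc (show B ∈ nhds (extChartAt (𝓡 (n + 1)) p (param p x)) by rwa [hr])] with y hy hyB
  exact ⟨_, ⟨(extChartAt (𝓡 (n + 1)) p).map_source hy, hyB⟩,
    (extChartAt (𝓡 (n + 1)) p).left_inv hy⟩

namespace IsDefiningFunction

variable {S V : Set M} {f : M → ℝ} (hf : IsDefiningFunction (n := n) S V f)
include hf

omit [IsManifold (𝓡 (n + 1)) ∞ M] in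
theorem mdifferentiableAt {q : M} (hq : q ∈ V) :
    MDifferentiableAt (𝓡 (n + 1)) 𝓘(ℝ, ℝ) f q :=
  (hf.smooth.contMDiffAt (hf.isOpen.mem_nhds hq)).mdifferentiableAt (by simp)

theorem contDiffOn_comp_param (p : M) :
    ContDiffOn ℝ ∞ (fun x ↦ f (param p x)) (dom n p ∩ param p ⁻¹' V) := fun _ hx ↦
  (contMDiffAt_iff_contDiffAt.1 ((hf.smooth.contMDiffAt (hf.isOpen.mem_nhds hx.2)).comp _
    (contMDiffAt_param hx.1))).contDiffWithinAt

theorem fderiv_comp_param (hx : x ∈ dom n p) (hxV : param p x ∈ V)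
    (v : EuclideanSpace ℝ (Fin (n + 1))) : fderiv ℝ (fun y ↦ f (param p y)) x v =
      mvfderiv (𝓡 (n + 1)) f (param p x) (dparam p x v) :=
  KillingHorizons.fderiv_comp_param hx (hf.mdifferentiableAt hxV) v

theorem fderiv_comp_param_ne_zero (hx : x ∈ dom n p) (hxV : param p x ∈ V) :
    fderiv ℝ (fun y ↦ f (param p y)) x ≠ 0 := by
  intro h
  refine hf.submersive _ hxV ?_
  ext z
  obtain ⟨v, rfl⟩ := dparam_surjective hx z
  rw [← hf.fderiv_comp_param hx hxV, h]
  rfl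

/-- The tangent space does not depend on the defining function. -/
theorem mvfderiv_eq_zero {q : M} {v : TangentSpace (𝓡 (n + 1)) q} (hqS : q ∈ S) (hqV : q ∈ V)
    (hv : IsTangent S q v) : mvfderiv (𝓡 (n + 1)) f q v = 0 := by
  obtain ⟨U, k, hqU, hk, hkv⟩ := hv
  obtain ⟨p, x, hx, rfl⟩ : ∃ (p : M) (x : EuclideanSpace ℝ (Fin (n + 1))),
    x ∈ dom n p ∧ param p x = q := ⟨q, exists_param_eq q⟩
  obtain ⟨w, rfl⟩ := dparam_surjective hx v
  rw [← hf.fderiv_comp_param hx hqV]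
  rw [← hk.fderiv_comp_param hx hqU] at hkv
  have hO1 := isOpen_dom_inter (n := n) (p := p) hf.isOpen
  have hO2 := isOpen_dom_inter (n := n) (p := p) hk.isOpen
  refine fderiv_apply_eq_zero_of_zeroSet
    ((contDiffAt_of_mem hO2 (hk.contDiffOn_comp_param p) ⟨hx, hqU⟩).of_le
      (by exact_mod_cast le_top))
    ((contDiffAt_of_mem hO1 (hf.contDiffOn_comp_param p) ⟨hx, hqV⟩).of_le
      (by exact_mod_cast le_top))
    (hk.fderiv_comp_param_ne_zero hx hqU) ((hk.zeroSet _ hqU).1 hqS) ?_ hkv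
  filter_upwards [hO1.mem_nhds ⟨hx, hqV⟩, hO2.mem_nhds ⟨hx, hqU⟩] with y hy1 hy2 hy
  exact (hf.zeroSet _ hy1.2).1 ((hk.zeroSet _ hy2.2).2 hy)

end IsDefiningFunction

variable {g : LorentzianMetric n M} {ξ η : VField n M}

/-- The degenerate direction `k` is null and orthogonal to the tangent null vector `ξ`, and
orthogonal null vectors are parallel in Lorentzian signature. -/
theorem IsKillingHorizon.val_eq_zero {K : Set M} (h : IsKillingHorizon g ξ K) {q : M} (hq : q ∈ K)
    {v : TangentSpace (𝓡 (n + 1)) q} (hv : IsTangent K q v) : g.val q (ξ q) v = 0 := by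
  obtain ⟨k, hk0, hkt, hk⟩ := h.nullHypersurface.degenerate q hq
  obtain ⟨c, hc⟩ := g.exists_eq_smul hk0 (hk k hkt) (hk _ (h.tangent q hq)) (h.isNull q hq)
  rw [hc, map_smul, smul_apply, hk v hv, smul_zero]

theorem IsKillingHorizon.coordHorizon {K V : Set M} {f : M → ℝ} (h : IsKillingHorizon g ξ K)
    (hf : IsDefiningFunction (n := n) K V f) (p : M) :
    CoordHorizon (dom n p ∩ param p ⁻¹' V) (pullMetric g p) (fun x ↦ f (param p x))
      (pullField p ξ) := by
  refine ⟨(coordMetric g p).mono (isOpen_dom_inter hf.isOpen) inter_subset_left,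
    (coordKilling h.killing p).mono inter_subset_left, hf.contDiffOn_comp_param p,
    fun x hx ↦ hf.fderiv_comp_param_ne_zero hx.1 hx.2, fun x hx h0 hξ ↦ ?_, fun x hx h0 ↦ ?_,
    fun x hx h0 X hX ↦ ?_⟩ <;> have hK := (hf.zeroSet _ hx.2).2 h0
  · refine h.ne_zero _ hK ?_
    rw [← dparam_pullField hx.1 ξ, hξ, map_zero]
  · rw [hf.fderiv_comp_param hx.1 hx.2, dparam_pullField hx.1]
    exact hf.mvfderiv_eq_zero hK hx.2 (h.tangent _ hK)
  · rw [hf.fderiv_comp_param hx.1 hx.2] at hX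
    rw [pullMetric_apply, dparam_pullField hx.1]
    exact h.val_eq_zero hK ⟨V, f, hx.2, hf, hX⟩

theorem isCovDerivAt_smul_iff (hξ : IsKilling g ξ) (hx : x ∈ dom n p) (κ : ℝ) :
    IsCovDerivAt g ξ ξ (param p x) (κ • ξ (param p x)) ↔
      ∀ v, curl (pullMetric g p) (pullField p ξ) x (pullField p ξ x) v =
        2 * κ * pullMetric g p x (pullField p ξ x) v := by
  rw [isCovDerivAt_self_iff hξ hx]
  refine forall_congr' fun v ↦ ?_
  rw [pullMetric_apply, dparam_pullField hx, map_smul, smul_apply, smul_eq_mul, eq_comm, mul_assoc]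

theorem IsKillingHorizon.exists_surfaceGravity {K : Set M} (h : IsKillingHorizon g ξ K) :
    ∃ κ : K → ℝ, IsSurfaceGravity g ξ K κ ∧
      ∀ κ' : K → ℝ, IsSurfaceGravity g ξ K κ' → κ' = κ := by
  have hex (q : K) : ∃ κ : ℝ, IsCovDerivAt g ξ ξ q (κ • ξ q) := by
    obtain ⟨q, hq⟩ := q
    obtain ⟨V, f, hqV, hf⟩ := h.nullHypersurface.hypersurface q hq
    obtain ⟨x, hx, hxq⟩ := exists_param_eq (n := n) q
    have hc := h.coordHorizon hf q
    have hxV : x ∈ dom n q ∩ param q ⁻¹' V := ⟨hx, by rwa [mem_preimage, hxq]⟩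
    have h0 : f (param q x) = 0 := by rw [hxq]; exact (hf.zeroSet q hqV).1 hq
    obtain ⟨κ, hκ⟩ := hc.exists_gravity hxV h0
      fun X hX ↦ hc.curl_tangent hxV h0 (hc.tangent x hxV h0) hX
    have := (isCovDerivAt_smul_iff h.killing hx κ).2 hκ
    rw [hxq] at this
    exact ⟨κ, this⟩
  choose κ hκ using hex
  refine ⟨κ, hκ, fun κ' hκ' ↦ funext fun q ↦ ?_⟩
  exact smul_left_injective ℝ (h.ne_zero q q.2) (IsCovDerivAt.unique g (hκ' q) (hκ q))

/-- Killing fields with proportional first jets at a point are proportional near the point. -/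
theorem eqOn_of_fderiv_eq (hξ : IsKilling g ξ) (hη : IsKilling g η) (c : ℝ) (hx : x ∈ dom n p)
    (h0 : pullField p η x = c • pullField p ξ x)
    (h1 : fderiv ℝ (pullField p η) x = c • fderiv ℝ (pullField p ξ) x)
    {y : EuclideanSpace ℝ (Fin (n + 1))} (hy : segment ℝ x y ⊆ dom n p) :
    η (param p y) = c • ξ (param p y) := by
  have hG := coordMetric g p
  have kξ := coordKilling hξ p
  have kη := coordKilling hη p
  have hyd := hy (right_mem_segment ℝ x y)
  have h := (kξ.sub_smul kη hG c).eq_zero_of_segment hG hy (sub_eq_zero.2 h0) (by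
    rw [fderiv_fun_sub (kη.diff hG hx) ((kξ.diff hG hx).fun_const_smul c),
      fderiv_fun_const_smul (kξ.diff hG hx), h1, sub_self])
  rw [← dparam_pullField hyd η, ← dparam_pullField hyd ξ, sub_eq_zero.1 h, map_smul]

/-- The interior of the coincidence set is open and closed: near a limit point, first jets agree
somewhere in a chart ball, and segments carry the agreement to the whole ball. -/
theorem eq_smul_of_fderiv_eq [ConnectedSpace M] (hξ : IsKilling g ξ) (hη : IsKilling g η) (c : ℝ)
    (hx : x ∈ dom n p) (h0 : pullField p η x = c • pullField p ξ x)
    (h1 : fderiv ℝ (pullField p η) x = c • fderiv ℝ (pullField p ξ) x) : η = c • ξ := by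
  set A := interior {q | η q = c • ξ q} with hA
  have ball {p : M} {x : EuclideanSpace ℝ (Fin (n + 1))} (hx : x ∈ dom n p) :
      ∃ ε > 0, Metric.ball x ε ⊆ dom n p := Metric.isOpen_iff.1 (isOpen_dom p) x hx
  have mem (p : M) (x y : EuclideanSpace ℝ (Fin (n + 1))) (ε : ℝ) (hε : 0 < ε)
      (hb : Metric.ball y ε ⊆ dom n p) (hxb : x ∈ Metric.ball y ε)
      (h0 : pullField p η x = c • pullField p ξ x)
      (h1 : fderiv ℝ (pullField p η) x = c • fderiv ℝ (pullField p ξ) x) : param p y ∈ A := by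
    rw [hA, mem_interior_iff_mem_nhds]
    filter_upwards [image_param_mem_nhds (hb (Metric.mem_ball_self hε))
      (Metric.ball_mem_nhds y hε)]
    rintro _ ⟨z, ⟨-, hz⟩, rfl⟩
    exact eqOn_of_fderiv_eq hξ hη c (hb hxb) h0 h1
      (((convex_ball y ε).segment_subset hxb hz).trans hb)
  have hclosed : IsClosed A := by
    refine isClosed_of_closure_subset fun q hq ↦ ?_
    obtain ⟨y, hy, hyq⟩ := exists_param_eq (n := n) q
    obtain ⟨ε, hε, hb⟩ := ball hy
    have hnhds := image_param_mem_nhds hy (Metric.ball_mem_nhds y hε)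
    rw [hyq] at hnhds
    obtain ⟨_, ⟨z, ⟨hzd, hz⟩, rfl⟩, hzA⟩ := mem_closure_iff_nhds.1 hq _ hnhds
    rw [← hyq]
    have hev : pullField q η =ᶠ[nhds z] fun w ↦ c • pullField q ξ w := by
      filter_upwards [(continuousAt_param hzd) (isOpen_interior.mem_nhds hzA),
        (isOpen_dom q).mem_nhds hzd] with w hw hwd
      apply dparam_injective hwd
      rw [map_smul, dparam_pullField hwd, dparam_pullField hwd]
      exact interior_subset (s := {q | η q = c • ξ q}) hw
    refine mem q z y ε hε hb hz hev.self_of_nhds ?_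
    rw [hev.fderiv_eq, fderiv_fun_const_smul ((coordKilling hξ q).diff (coordMetric g q) hzd)]
  have hne : A.Nonempty := by
    obtain ⟨ε, hε, hb⟩ := ball hx
    exact ⟨_, mem p x x ε hε hb (Metric.mem_ball_self hε) h0 h1⟩
  have huniv : A = univ := IsClopen.eq_univ ⟨hclosed, isOpen_interior⟩ hne
  funext q
  have hq : q ∈ A := huniv ▸ mem_univ q
  exact interior_subset (s := {q | η q = c • ξ q}) hq

/-- The surface gravity of a Killing horizon is constant, if the closure of the horizon is the
closure of a horizon of an independent Killing field. -/
theorem IsKillingHorizon.exists_surfaceGravity_eq_const [ConnectedSpace M] {K L : Set M}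
    (h : IsKillingHorizon g ξ K) (h' : IsKillingHorizon g η L) (hKL : closure K = closure L)
    (hind : ∀ c : ℝ, η ≠ c • ξ) {κ : K → ℝ} (hκ : IsSurfaceGravity g ξ K κ) :
    ∃ c : ℝ, ∀ q, κ q = c := by
  have hK := h.nullHypersurface.hypersurface
  have hL := h'.nullHypersurface.hypersurface
  -- `K` itself may be disconnected, so connectedness is used on the hypersurface part of its
  -- closure, where `ξ` may vanish.
  refine exists_eq_const_of_locally h.isPreconnected (subset_hypersurfaceInterior_closure hK)
    (fun q hq ↦ hq.1) κ fun p hp ↦ ?_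
  obtain ⟨hpC, V, f, hpV, hf⟩ := hp
  obtain ⟨x₀, hx₀, hx₀p⟩ := exists_param_eq (n := n) p
  set U := dom n p ∩ param p ⁻¹' V with hU
  have hUo : IsOpen U := isOpen_dom_inter hf.isOpen
  have hx₀V : param p x₀ ∈ V := by rwa [hx₀p]
  have hUd : U ⊆ dom n p := inter_subset_left
  -- Near a point of `J` the set `J` coincides with the common closure, so the same `f` defines it;
  -- one `ψ` thus serves both fields.
  have horizon {J : Set M} {ζ : VField n M} (hJ : IsKillingHorizon g ζ J)
      (hJK : closure K = closure J) (s : EuclideanSpace ℝ (Fin (n + 1))) (hs : s ∈ U)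
      (hsJ : param p s ∈ J) : ∃ W, IsOpen W ∧ s ∈ W ∧
        CoordHorizon W (pullMetric g p) (fun x ↦ f (param p x)) (pullField p ζ) := by
    obtain ⟨O, hO, hsO, hOJ⟩ := exists_isOpen_inter_closure hJ.nullHypersurface.hypersurface hsJ
    have hfJ : IsDefiningFunction (n := n) J (V ∩ O) f :=
      hf.congr (hf.isOpen.inter hO) inter_subset_left
        fun y hy ↦ ⟨fun hyK ↦ hOJ y hy.2 (hJK ▸ hyK), fun hyJ ↦ hJK ▸ subset_closure hyJ⟩
    exact ⟨_, isOpen_dom_inter hfJ.isOpen, ⟨hUd hs, hs.2, hsO⟩, hJ.coordHorizon hfJ p⟩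
  obtain ⟨c, hc⟩ := exists_eventually_gravity_eq (U := U) (ψ := fun x ↦ f (param p x))
    (η := pullField p η) (S := {x | x ∈ dom n p ∧ param p x ∈ K ∩ L}) (p := x₀)
    ((coordMetric g p).mono hUo hUd) ((coordKilling h.killing p).mono hUd)
    (hf.contDiffOn_comp_param p)
    (fun s hs hsU ↦ by
      obtain ⟨W₁, hW₁, hs₁, h₁⟩ := horizon h rfl s hsU hs.2.1
      obtain ⟨W₂, hW₂, hs₂, h₂⟩ := horizon h' hKL s hsU hs.2.2
      exact ⟨W₁ ∩ W₂, hW₁.inter hW₂, ⟨hs₁, hs₂⟩, h₁.mono (hW₁.inter hW₂) inter_subset_left,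
        h₂.mono (hW₁.inter hW₂) inter_subset_right⟩)
    (fun s hs hsU ↦ (hf.zeroSet _ hsU.2).1 (subset_closure hs.2.1))
    (fun q hq c h0 h1 ↦ hind c (eq_smul_of_fderiv_eq h.killing h'.killing c (hUd hq) h0 h1))
    (fun x hx hx0 ↦ by
      have hxC := closure_subset_closure_inter hK hKL ((hf.zeroSet _ hx.2).2 hx0)
      rw [mem_closure_iff_nhds]
      intro t ht
      obtain ⟨_, ⟨y, ⟨hyd, hyt⟩, rfl⟩, hyS⟩ :=
        mem_closure_iff_nhds.1 hxC _ (image_param_mem_nhds (hUd hx) ht)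
      exact ⟨y, hyt, hyd, hyS⟩)
    ⟨hx₀, hx₀V⟩ ((hf.zeroSet _ hx₀V).1 (by rwa [hx₀p])) (hf.fderiv_comp_param_ne_zero hx₀ hx₀V)
  obtain ⟨B, hBc, hB, hx₀B⟩ := eventually_nhds_iff.1 (hc.and (hUo.mem_nhds ⟨hx₀, hx₀V⟩))
  have hnhds := image_param_mem_nhds hx₀ (hB.mem_nhds hx₀B)
  rw [hx₀p] at hnhds
  obtain ⟨O, hOB, hO, hpO⟩ := mem_nhds_iff.1 hnhds
  refine ⟨c, O, hO, hpO, ?_⟩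
  rintro ⟨q, hqK⟩ hqO
  obtain ⟨y, ⟨hyd, hyB⟩, rfl⟩ := hOB hqO
  obtain ⟨hyc, hyU⟩ := hBc y hyB
  have hy0 : f (param p y) = 0 := (hf.zeroSet _ hyU.2).1 (subset_closure hqK)
  obtain ⟨W, hW, hyW, hh⟩ := horizon h rfl y hyU hqK
  exact hyc hy0 (hh.ne_zero y hyW hy0) (hh.normal y hyW hy0) _
    ((isCovDerivAt_smul_iff h.killing hyd _).1 (hκ ⟨_, hqK⟩))

/-- A multiple Killing horizon is a horizon of a Killing field independent of a given one. -/
theorem IsMultipleKillingHorizon.exists_independent {H : Set M}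
    (hH : IsMultipleKillingHorizon g H) (ξ : VField n M) : ∃ (η : VField n M) (L : Set M),
      IsKillingHorizon g η L ∧ closure L = closure H ∧ ∀ c : ℝ, η ≠ c • ξ := by
  obtain ⟨m, hm, ζ, K, hind, hK⟩ := hH.multiple
  by_contra! hc
  let i : Fin m := ⟨0, by omega⟩
  let j : Fin m := ⟨1, by omega⟩
  obtain ⟨a, ha⟩ := hc (ζ i) (K i) (hK i).1 (hK i).2
  obtain ⟨b, hb⟩ := hc (ζ j) (K j) (hK j).1 (hK j).2
  have hpair := hind.comp ![i, j] (by
    intro k l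
    fin_cases k <;> fin_cases l <;> simp [i, j])
  have hpair' : LinearIndependent ℝ ![ζ i, ζ j] := by
    convert hpair using 1
    ext k
    fin_cases k <;> rfl
  -- Two multiples `a ξ` and `b ξ` satisfy `b (a ξ) - a (b ξ) = 0`; independence gives `a = 0`, so
  -- the first field is zero.
  have hab := LinearIndependent.pair_iff.1 hpair' b (-a) (by rw [ha, hb]; module)
  refine hind.ne_zero i ?_
  rw [ha, neg_eq_zero.1 hab.2, zero_smul]

end Coordinates

end Horizons

end KillingHorizons

/-! ### The theorem -/

open KillingHorizons in
theorem mainTheorem3 {n : ℕ} (hn : 1 ≤ n)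
    {M : Type*} [TopologicalSpace M] [T2Space M] [SecondCountableTopology M] [ConnectedSpace M]
    [ChartedSpace (EuclideanSpace ℝ (Fin (n + 1))) M] [IsManifold (𝓡 (n + 1)) ∞ M]
    (g : LorentzianMetric n M) (H : Set M) (hH : IsMultipleKillingHorizon g H)
    (ξ η : VField n M) (Hξ Hη : Set M)
    (hξ : IsKillingHorizon g ξ Hξ) (hη : IsKillingHorizon g η Hη)
    (hξH : closure Hξ = closure H) (hηH : closure Hη = closure H) :
    ∃ (κξ : Hξ → ℝ) (κη : Hη → ℝ),
      (IsSurfaceGravity g ξ Hξ κξ ∧ ∀ κ : Hξ → ℝ, IsSurfaceGravity g ξ Hξ κ → κ = κξ) ∧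
      (IsSurfaceGravity g η Hη κη ∧ ∀ κ : Hη → ℝ, IsSurfaceGravity g η Hη κ → κ = κη) ∧
      (∃ c : ℝ, ∀ p : Hξ, κξ p = c) ∧ (∃ c : ℝ, ∀ p : Hη, κη p = c) := by
  -- `ξ` and `η` may be proportional, so each is paired with a companion taken from the fields
  -- defining the multiple horizon.
  have key (ζ : VField n M) (K : Set M) (hζ : IsKillingHorizon g ζ K)
      (hK : closure K = closure H) : ∃ κ : K → ℝ, (IsSurfaceGravity g ζ K κ ∧
        ∀ κ' : K → ℝ, IsSurfaceGravity g ζ K κ' → κ' = κ) ∧ ∃ c : ℝ, ∀ p, κ p = c := by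
    obtain ⟨χ, L, hL, hLH, hind⟩ := hH.exists_independent ζ
    obtain ⟨κ, hκ, huniq⟩ := hζ.exists_surfaceGravity
    exact ⟨κ, ⟨hκ, huniq⟩, hζ.exists_surfaceGravity_eq_const hL (hK.trans hLH.symm) hind hκ⟩
  obtain ⟨κξ, h1, h2⟩ := key ξ Hξ hξ hξH
  obtain ⟨κη, h3, h4⟩ := key η Hη hη hηH
  exact ⟨κξ, κη, h1, h3, h2, h4⟩
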